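/- Let $(V,h)$ be an oriented eight-dimensional Euclidean vector space with dual metric $h^*$ on $V^*$ and volume form $\nu=e^1\wedge\dots\wedge e^8$ ($e^1,\dots,e^8$ the dual basis of a positively oriented orthonormal basis). On $\wedge V^*_{\mathbb C}$ let $\diamond$ be the geometric (Kähler–Atiyah) product, i.e. the associative $\mathbb C$-bilinear product with $\theta\diamond\alpha=\theta\wedge\alpha+\iota_{\theta^\sharp}\alpha$ for one-forms $\theta$; $(\wedge V^*_{\mathbb C},\diamond)$ is thereby identified with the complex Clifford algebra of $(V^*,h^*)$, with $\theta^2=h^*(\theta,\theta)$. For $\alpha\in\wedge^aV^*_{\mathbb C}$, $\beta\in\wedge^bV^*_{\mathbb C}$ the generalized products $\alpha\triangle_k\beta\in\wedge^{a+b-2k}V^*_{\mathbb C}$ are defined by $\alpha\diamond\beta=\sum_k(-1)^{\binom{k+1}{2}+ak}\,\alpha\triangle_k\beta$. Let $\langle\cdot,\cdot\rangle$ be the complex-bilinear extension of the metric to forms, $\langle\theta_1\wedge\dots\wedge\theta_k,\eta_1\wedge\dots\wedge\eta_k\rangle=\det(h^*(\theta_i,\eta_j))$, and $*$ the complex-linear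 Hodge star, $\psi\wedge *\alpha=\langle\psi,\alpha\rangle\nu$. Let $(\Sigma,\gamma)$ be an irreducible complex module of the complex Clifford algebra, with the induced map $\Psi_\gamma:\wedge V^*_{\mathbb C}\to\mathrm{End}(\Sigma)$, and let $\mathscr B$ be a non-degenerate symmetric complex-bilinear form on $\Sigma$ with $\mathscr B(\gamma(z)\xi,\chi)=\mathscr B(\xi,\gamma(\tau(z))\chi)$ for all $z$, where $\tau$ is the reversion anti-automorphism. Then $\Psi_\gamma$ is bijective, and the complex-bilinear square of $\eta\in\Sigma$ is the form $\alpha_\eta:=\Psi_\gamma^{-1}(\eta\otimes\mathscr B(-,\eta))\in\wedge V^*_{\mathbb C}$. Let $\mu\in\{1,-1\}$ and let $\Sigma^\mu=\{\eta\in\Sigma:\Psi_\gamma(\nu)\eta=\mu\eta\}$ be the spinors of chirality $\mu$. (1) For every $\eta\in\Sigma^\mu$ there are $\Omega\in\wedge^4V^*_{\mathbb C}$ and a complex square root $s$ of $\langle\Omega,\Omega\rangle$ (that is, $s^2=\langle\Omega,\Omega\rangle$) such that $$*\Omega=\mu\Omega,\qquad \sqrt{14}\,\Omega\triangle_2\Omega+12\,s\,\Omega=0,\tag{A}$$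 $$\alpha_\eta=\frac{s}{\sqrt{14}}+\Omega+\frac{\mu s}{\sqrt{14}}\,\nu ,\tag{B}$$ and $\mathscr B(\eta,\eta)\neq0$ if and only if $\langle\Omega,\Omega\rangle\neq0$. (2) A form $\alpha\in\wedge V^*_{\mathbb C}$ equals $\alpha_\eta$ for some $\eta\in\Sigma^\mu$ with $\mathscr B(\eta,\eta)\neq0$ (an impure spinor) if and only if $$\alpha=\frac{s}{\sqrt{14}}+\Omega+\frac{\mu s}{\sqrt{14}}\,\nu$$ for some $\Omega\in\wedge^4V^*_{\mathbb C}$ with $\langle\Omega,\Omega\rangle\neq0$ and some square root $s$ of $\langle\Omega,\Omega\rangle$ satisfying (A). (3) Likewise, $\alpha$ equals $\alpha_\eta$ for some $\eta\in\Sigma^\mu$ with $\mathscr B(\eta,\eta)\neq0$ if and only if $$\alpha=\frac{s}{\sqrt{14}}+\Omega+\frac{\Omega\wedge\Omega}{\sqrt{14}\,s}$$ for some $\Omega\in\wedge^4V^*_{\mathbb C}$ with $\langle\Omega,\Omega\rangle\neq0$ and some square root $s$ of $\langle\Omega,\Omega\rangle$ satisfying (A). -/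

import Mathlib

/-!
Complex exterior forms on an eight-dimensional oriented Euclidean vector space `V`, the
Kähler-Atiyah (geometric) product, irreducible complex Clifford modules, and the complex-bilinear
square of a spinor.
-/

noncomputable section

namespace SpinorSquare

open scoped TensorProduct

section Forms

variable (V : Type*) [NormedAddCommGroup V] [InnerProductSpace ℝ V] [FiniteDimensional ℝ V]

/-- The vector `θ♯` metrically dual to a one-form `θ`. -/
def sharp (θ : Module.Dual ℝ V) : V :=
  haveI : CompleteSpace V := FiniteDimensional.complete ℝ V
  (InnerProductSpace.toDual ℝ V).symm (LinearMap.toContinuousLinearMap θ)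

variable {V} in
theorem inner_sharp (θ : Module.Dual ℝ V) (v : V) : inner ℝ (sharp V θ) v = θ v := by
  have : CompleteSpace V := FiniteDimensional.complete ℝ V
  simp [sharp]

/-- The metric `h*` on `V*` dual to the inner product of `V`. -/
def dualMetric : LinearMap.BilinForm ℝ (Module.Dual ℝ V) :=
  LinearMap.mk₂ ℝ (fun θ θ' => inner ℝ (sharp V θ) (sharp V θ'))
    (fun a b c => by simp [inner_sharp])
    (fun r a b => by simp [inner_sharp])
    (fun a b c => by
      rw [real_inner_comm, real_inner_comm (sharp V b), real_inner_comm (sharp V c)]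
      simp [inner_sharp])
    (fun r a b => by
      rw [real_inner_comm, real_inner_comm (sharp V b)]
      simp [inner_sharp])

/-- The complexification of `V*`. -/
abbrev ComplexDual : Type _ := ℂ ⊗[ℝ] Module.Dual ℝ V

/-- The complex-bilinear extension of `h*` to the complexification of `V*`. -/
def complexMetric : LinearMap.BilinForm ℂ (ComplexDual V) :=
  LinearMap.BilinForm.baseChange ℂ (dualMetric V)

/-- The quadratic form `θ ↦ h*(θ, θ)` on the complexification of `V*`. -/
def complexQuadraticForm : QuadraticForm ℂ (ComplexDual V) :=
  LinearMap.BilinMap.toQuadraticMap (complexMetric V)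

/-- The algebra of complex exterior forms. -/
abbrev Forms : Type _ := ExteriorAlgebra ℂ (ComplexDual V)

/-- The complex exterior forms of degree `k`. -/
abbrev KForms (k : ℕ) : Submodule ℂ (Forms V) := ⋀[ℂ]^k (ComplexDual V)

/-- The complex Clifford algebra, with the convention `θ ^ 2 = h*(θ, θ)`. -/
abbrev ComplexClifford : Type _ := CliffordAlgebra (complexQuadraticForm V)

/-- The Chevalley-Riesz isomorphism from exterior forms to the Clifford algebra. -/
def chevalleyRiesz : Forms V ≃ₗ[ℂ] ComplexClifford V :=
  letI : Invertible (2 : ℂ) := invertibleOfNonzero two_ne_zero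
  (CliffordAlgebra.equivExterior (complexQuadraticForm V)).symm

variable {V}

/-- The geometric product `α ⋄ β` of exterior forms. -/
def geometricProduct (α β : Forms V) : Forms V :=
  (chevalleyRiesz V).symm (chevalleyRiesz V α * chevalleyRiesz V β)

/-- The generalized product `α △ₖ β` of a form `α` of degree `a` and a form `β` of degree `b`.
It is the form of degree `a + b - 2k` determined by
`α ⋄ β = ∑ₖ (-1) ^ (choose (k + 1) 2 + a k) α △ₖ β`. -/
def generalizedProduct (k : ℕ) {a b : ℕ} (α : KForms V a) (β : KForms V b) : Forms V :=
  if 2 * k ≤ a + b then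
    (-1 : ℂ) ^ ((k + 1).choose 2 + a * k) •
      GradedAlgebra.proj (fun n : ℕ => KForms V n) (a + b - 2 * k)
        (geometricProduct (α : Forms V) (β : Forms V))
  else 0

/-- The complex-bilinear pairing of `k`-forms induced by the metric,
`⟨θ₁ ∧ ⋯ ∧ θₖ, η₁ ∧ ⋯ ∧ ηₖ⟩ = det (h*(θᵢ, ηⱼ))`. -/
def formPairing {k : ℕ} (α β : KForms V k) : ℂ :=
  exteriorPower.pairingDual ℂ (ComplexDual V) k
    (exteriorPower.map k (complexMetric V) α) β

/-- The volume form `ν = e¹ ∧ ⋯ ∧ e⁸` of an oriented eight-dimensional Euclidean space, where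
`e` is a positively oriented orthonormal basis. -/
def volumeForm (hV : Module.finrank ℝ V = 8) (o : Orientation ℝ V (Fin 8)) : Forms V :=
  ExteriorAlgebra.ιMulti ℂ 8 fun i =>
    (1 : ℂ) ⊗ₜ[ℝ] innerₗ V (o.finOrthonormalBasis (by norm_num) hV i)

/-- `IsHodgeDual hV o α β` says that `∗α = β`, for `4`-forms `α` and `β`:
`ψ ∧ β = ⟨ψ, α⟩ ν` for every `4`-form `ψ`. -/
def IsHodgeDual (hV : Module.finrank ℝ V = 8) (o : Orientation ℝ V (Fin 8))
    (α β : KForms V 4) : Prop :=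
  ∀ ψ : KForms V 4, (ψ : Forms V) * (β : Forms V) = formPairing ψ α • volumeForm hV o

end Forms

section Spinors

variable {V : Type*} [NormedAddCommGroup V] [InnerProductSpace ℝ V] [FiniteDimensional ℝ V]
variable {S : Type*} [AddCommGroup S] [Module ℂ S]

/-- The Clifford module `(S, γ)` is irreducible. -/
def IsIrreducibleModule (γ : ComplexClifford V →ₐ[ℂ] Module.End ℂ S) : Prop :=
  Representation.IsIrreducible (γ : ComplexClifford V →* Module.End ℂ S)

/-- A symmetric admissible complex-bilinear pairing of positive adjoint type; `reverse` is the
anti-automorphism `τ` of the Clifford algebra that is the identity on one-forms. -/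
structure IsAdmissiblePairing (γ : ComplexClifford V →ₐ[ℂ] Module.End ℂ S)
    (B : LinearMap.BilinForm ℂ S) : Prop where
  nondegenerate : B.Nondegenerate
  symm : ∀ ξ χ : S, B ξ χ = B χ ξ
  adjoint : ∀ (z : ComplexClifford V) (ξ χ : S),
    B (γ z ξ) χ = B ξ (γ (CliffordAlgebra.reverse z) χ)

/-- The map from exterior forms to endomorphisms of `S`: the Chevalley-Riesz isomorphism followed
by the Clifford module structure. -/
def quantization (γ : ComplexClifford V →ₐ[ℂ] Module.End ℂ S) : Forms V →ₗ[ℂ] Module.End ℂ S :=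
  γ.toLinearMap ∘ₗ (chevalleyRiesz V).toLinearMap

/-- The endomorphism `η ⊗ η* : χ ↦ B(χ, η) η`. -/
def squareEnd (B : LinearMap.BilinForm ℂ S) (η : S) : Module.End ℂ S :=
  (B.flip η).smulRight η

/-- The complex-bilinear square of the spinor `η`: the image of `η ⊗ η*` under the inverse of
`quantization γ`, which is bijective when `(S, γ)` is irreducible. -/
def bilinearSquare (γ : ComplexClifford V →ₐ[ℂ] Module.End ℂ S) (B : LinearMap.BilinForm ℂ S)
    (η : S) : Forms V :=
  Function.invFun (quantization γ) (squareEnd B η)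

/-- The spinor `η` is chiral of chirality `μ`: the volume form acts on it as `μ`. (In eight
Euclidean dimensions the complex volume form is `i ^ 4 ν = ν`.) -/
def IsChiral (hV : Module.finrank ℝ V = 8) (o : Orientation ℝ V (Fin 8))
    (γ : ComplexClifford V →ₐ[ℂ] Module.End ℂ S) (μ : ℤˣ) (η : S) : Prop :=
  quantization γ (volumeForm hV o) η = ((μ : ℤ) : ℂ) • η

end Spinors

section Conditions

variable {V : Type*} [NormedAddCommGroup V] [InnerProductSpace ℝ V] [FiniteDimensional ℝ V]

/-- The algebraic conditions on a complex `4`-form `Ω` and a square root `s` of `⟨Ω, Ω⟩`: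
`∗Ω = μ Ω` and `√14 Ω △₂ Ω + 12 s Ω = 0`. -/
structure SquareConditions (hV : Module.finrank ℝ V = 8) (o : Orientation ℝ V (Fin 8)) (μ : ℤˣ)
    (Ω : KForms V 4) (s : ℂ) : Prop where
  root : s ^ 2 = formPairing Ω Ω
  selfDual : IsHodgeDual hV o Ω (((μ : ℤ) : ℂ) • Ω)
  quadratic : ((√14 : ℝ) : ℂ) • generalizedProduct 2 Ω Ω + (12 * s) • (Ω : Forms V) = 0

end Conditions

end SpinorSquare

end

/-! The Chevalley-Riesz map moves everything into the Clifford algebra, where the ordered products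
of an orthonormal coframe form a basis of 256 elements. By Burnside's theorem and this basis, `γ` is
an isomorphism onto the endomorphisms of a 16-dimensional space (`bijective_of_irreducible`,
`finrank_spinors`), so squares of spinors can be recognised inside the Clifford algebra.

For `a ≠ 0`, an endomorphism `T` is the square of a spinor with `B η η = a` exactly when it is
`B`-self-adjoint with `T * T = a • T` and trace `a`: then `a⁻¹ • T` is an idempotent of trace one,
hence of rank one, and self-adjointness forces its functional to be a multiple of a pairing with the
spanning vector (`exists_eq_squareEnd`).

Under `γ` the adjoint is reversion, the trace is 16 times the scalar coefficient (`trace_apply`),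
and chirality is multiplication by the volume element `N`. The conditions on `z` with scalar
coefficient `c` become `reverse z = z`, `N * z = μ z` and `z * z = 16 c z`. Reversion removes
degrees 2, 3, 6, 7 and commutation with `N` removes the odd degrees (`eq_add_fourPart_add`), so `z =
c + W + μ c N` with `W` of degree four. The quadratic relation for `z` is then `W * W = 14 c² (1 + μ
N) + 12 c W`. Its scalar part says that `s = √14 c` is a root of `⟨Ω, Ω⟩`, its degree-four part is
the `△₂` equation, and its top part follows from self-duality (`squareConditions_iff`).

The passage from spinors to forms works for every `c`; the converse divides by `c`, hence the
restriction to impure spinors. -/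

noncomputable section

namespace SpinorSquare

open scoped TensorProduct symmDiff

/-! ### Ordered products of anticommuting involutions. -/

section Words

/-- The sign is the one by which conjugation by `e i` acts on the product over `I`. An element of
`I` serves when `I` has even size, an element outside when the size is odd; evenness of `n` rules
out that `I` is then everything. -/
theorem exists_conj_sign_eq_neg_one {n : ℕ} (hn : Even n) {I : Finset (Fin n)} (hI : I ≠ ∅) :
    ∃ i, ((if i ∈ I then -1 else 1) * (-1) ^ I.card : ℂ) = -1 := by
  rcases Nat.even_or_odd I.card with h | h
  · obtain ⟨i, hi⟩ := Finset.nonempty_iff_ne_empty.2 hI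
    exact ⟨i, by simp [hi, h.neg_one_pow]⟩
  · have : I ≠ Finset.univ := by
      rintro rfl
      rw [Finset.card_univ, Fintype.card_fin] at h
      exact Nat.not_even_iff_odd.2 h hn
    obtain ⟨i, hi⟩ : ∃ i, i ∉ I := by
      by_contra! h
      exact this (Finset.eq_univ_iff_forall.2 h)
    exact ⟨i, by simp [hi, h.neg_one_pow]⟩

variable {A : Type*} [Ring A]

/-- Pairwise anticommuting elements that square to one. -/
structure IsCliffordFamily {n : ℕ} (e : Fin n → A) : Prop where
  sq : ∀ i, e i * e i = 1
  anticomm : ∀ i j, i ≠ j → e i * e j = -(e j * e i)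

/-- The product of the `e i`, `i ∈ I`, in increasing order. -/
def word {n : ℕ} (e : Fin n → A) (I : Finset (Fin n)) : A := ((I.sort).map e).prod

variable {n : ℕ} {e : Fin n → A}

@[simp] theorem word_empty : word e ∅ = 1 := by simp [word]

theorem IsCliffordFamily.prod_mul_reverse_prod (he : IsCliffordFamily e) (l : List (Fin n)) :
    (l.map e).prod * (l.reverse.map e).prod = 1 := by
  induction l with
  | nil => simp
  | cons i l ih =>
    simp only [List.reverse_cons, List.map_append, List.map_cons, List.map_nil, List.prod_append,
      List.prod_cons, List.prod_nil, mul_one]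
    rw [mul_assoc, ← mul_assoc _ _ (e i), ih, one_mul, he.sq]

variable [Algebra ℂ A]

theorem map_word {A' : Type*} [Ring A'] [Algebra ℂ A'] (f : A →ₐ[ℂ] A') (I : Finset (Fin n)) :
    f (word e I) = word (f ∘ e) I := by
  simp [word, map_list_prod]

namespace IsCliffordFamily

theorem map {A' : Type*} [Ring A'] [Algebra ℂ A'] (he : IsCliffordFamily e) (f : A →ₐ[ℂ] A') :
    IsCliffordFamily (f ∘ e) where
  sq i := by simp [← map_mul, he.sq]
  anticomm i j hij := by simp [← map_mul, he.anticomm i j hij]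

variable (he : IsCliffordFamily e)
include he

/-- Swapping distinct generators changes only a sign. The sign is left unspecified, since later
arguments need at most that it is nonzero. -/
theorem prod_perm {l l' : List (Fin n)} (h : l.Perm l') (hl : l.Nodup) :
    ∃ c : ℂ, c ≠ 0 ∧ (l.map e).prod = c • (l'.map e).prod := by
  induction h with
  | nil => exact ⟨1, one_ne_zero, by simp⟩
  | cons x h ih =>
    obtain ⟨c, hc, h⟩ := ih (List.nodup_cons.1 hl).2
    exact ⟨c, hc, by simp [h]⟩
  | swap x y l =>
    refine ⟨-1, by simp, ?_⟩
    have hxy : y ≠ x := by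
      rintro rfl
      simp at hl
    simp only [List.map_cons, List.prod_cons, ← mul_assoc, he.anticomm y x hxy]
    simp
  | trans h₁ h₂ ih₁ ih₂ =>
    obtain ⟨c, hc, hh⟩ := ih₁ hl
    obtain ⟨d, hd, hh'⟩ := ih₂ (h₁.nodup_iff.1 hl)
    exact ⟨c * d, mul_ne_zero hc hd, by rw [hh, hh', smul_smul]⟩

theorem prod_eq_smul_word {l : List (Fin n)} (hl : l.Nodup) :
    ∃ c : ℂ, c ≠ 0 ∧ (l.map e).prod = c • word e l.toFinset :=
  he.prod_perm (List.perm_of_nodup_nodup_toFinset_eq hl (Finset.sort_nodup _ _) (by simp)) hl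

theorem mul_word (i : Fin n) (I : Finset (Fin n)) :
    ∃ c : ℂ, c ≠ 0 ∧ e i * word e I = c • word e ({i} ∆ I) := by
  have key : ∀ J : Finset (Fin n), i ∉ J → ∃ c : ℂ, c ≠ 0 ∧
      e i * word e J = c • word e (insert i J) := by
    intro J hJ
    have := he.prod_eq_smul_word (l := i :: J.sort) (by simp [hJ])
    simpa [word] using this
  by_cases hi : i ∈ I
  · obtain ⟨c, hc, h⟩ := key (I.erase i) (by simp)
    have h1 : ({i} : Finset (Fin n)) ∆ I = I.erase i := by
      ext j
      by_cases hj : j = i <;> simp [Finset.mem_symmDiff, hj, hi]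
    rw [Finset.insert_erase hi] at h
    refine ⟨c⁻¹, inv_ne_zero hc, ?_⟩
    rw [h1, eq_inv_smul_iff₀ hc, ← mul_smul_comm, ← h, ← mul_assoc, he.sq, one_mul]
  · have h1 : ({i} : Finset (Fin n)) ∆ I = insert i I := by
      ext j
      by_cases hj : j = i <;> simp [Finset.mem_symmDiff, hj, hi]
    rw [h1]
    exact key I hi

theorem word_mul_word (I J : Finset (Fin n)) :
    ∃ c : ℂ, c ≠ 0 ∧ word e I * word e J = c • word e (I ∆ J) := by
  have key : ∀ l : List (Fin n), l.Nodup → ∃ c : ℂ, c ≠ 0 ∧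
      (l.map e).prod * word e J = c • word e (l.toFinset ∆ J) := by
    intro l hl
    induction l with
    | nil => exact ⟨1, one_ne_zero, by
        rw [List.toFinset_nil, show (∅ : Finset (Fin n)) ∆ J = J from bot_symmDiff J]; simp⟩
    | cons i l ih =>
      obtain ⟨hi, hl⟩ := List.nodup_cons.1 hl
      obtain ⟨c, hc, h⟩ := ih hl
      obtain ⟨d, hd, h'⟩ := he.mul_word i (l.toFinset ∆ J)
      refine ⟨c * d, mul_ne_zero hc hd, ?_⟩
      have h1 : (i :: l).toFinset = {i} ∆ l.toFinset := by
        ext j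
        by_cases hj : j = i <;> simp [Finset.mem_symmDiff, hj, hi]
      rw [List.map_cons, List.prod_cons, mul_assoc, h, mul_smul_comm, h', smul_smul, h1,
        symmDiff_assoc]
  have h := key I.sort (Finset.sort_nodup _ _)
  rwa [Finset.sort_toFinset] at h

theorem conj_prod (i : Fin n) {l : List (Fin n)} (hl : l.Nodup) :
    e i * (l.map e).prod * e i =
      ((if i ∈ l then -1 else 1) * (-1) ^ l.length : ℂ) • (l.map e).prod := by
  induction l with
  | nil => simp [he.sq]
  | cons j l ih =>
    obtain ⟨hj, hl⟩ := List.nodup_cons.1 hl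
    specialize ih hl
    by_cases hij : i = j
    · subst hij
      simp only [hj, if_false, one_mul] at ih
      have h : (l.map e).prod * e i = ((-1) ^ l.length : ℂ) • (e i * (l.map e).prod) := by
        rw [← mul_smul_comm, ← ih, mul_assoc, ← mul_assoc, he.sq, one_mul]
      simp only [List.map_cons, List.prod_cons, List.mem_cons_self, if_true, List.length_cons]
      rw [← mul_assoc, he.sq, one_mul, h]
      congr 1
      ring
    · simp only [List.map_cons, List.prod_cons, List.mem_cons, hij, false_or, List.length_cons]
      rw [← mul_assoc, he.anticomm i j hij, neg_mul, neg_mul, mul_assoc, mul_assoc,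
        ← mul_assoc (e i), ih, mul_smul_comm, ← neg_smul]
      congr 1
      ring

theorem conj_word (i : Fin n) (I : Finset (Fin n)) :
    e i * word e I * e i = ((if i ∈ I then -1 else 1) * (-1) ^ I.card : ℂ) • word e I := by
  simpa [word] using he.conj_prod i (Finset.sort_nodup I (· ≤ ·))

theorem reverse_prod {l : List (Fin n)} (hl : l.Nodup) :
    (l.reverse.map e).prod = ((-1) ^ l.length.choose 2 : ℂ) • (l.map e).prod := by
  induction l with
  | nil => simp
  | cons i l ih =>
    obtain ⟨hi, hl⟩ := List.nodup_cons.1 hl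
    have h := he.conj_prod i hl
    simp only [hi, if_false, one_mul] at h
    have h' : (l.map e).prod * e i = ((-1) ^ l.length : ℂ) • (e i * (l.map e).prod) := by
      rw [← mul_smul_comm, ← h, mul_assoc, ← mul_assoc, he.sq, one_mul]
    simp only [List.reverse_cons, List.map_append, List.map_cons, List.map_nil, List.prod_append,
      List.prod_cons, List.prod_nil, mul_one, List.length_cons]
    rw [ih hl, smul_mul_assoc, h', smul_smul, Nat.choose_succ_succ' l.length 1, Nat.choose_one_right,
      pow_add]
    congr 1
    ring

theorem word_mul_self (I : Finset (Fin n)) :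
    word e I * word e I = ((-1) ^ I.card.choose 2 : ℂ) • 1 := by
  have h := he.prod_mul_reverse_prod I.sort
  rw [he.reverse_prod (Finset.sort_nodup I _), Finset.length_sort, mul_smul_comm] at h
  rw [← h, smul_smul, ← mul_pow]
  simp [word]

theorem word_univ_mul_word (hn : Even n) (I : Finset (Fin n)) :
    word e Finset.univ * word e I = ((-1) ^ I.card : ℂ) • (word e I * word e Finset.univ) := by
  have key : ∀ l : List (Fin n), word e Finset.univ * (l.map e).prod =
      ((-1) ^ l.length : ℂ) • ((l.map e).prod * word e Finset.univ) := by
    intro l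
    induction l with
    | nil => simp
    | cons i l ih =>
      have h := he.conj_word i Finset.univ
      simp only [Finset.mem_univ, if_true, Finset.card_univ, Fintype.card_fin, hn.neg_one_pow,
        mul_one] at h
      have h' : word e Finset.univ * e i = (-1 : ℂ) • (e i * word e Finset.univ) := by
        rw [← mul_smul_comm, ← h, mul_assoc, ← mul_assoc, he.sq, one_mul]
      rw [List.map_cons, List.prod_cons, ← mul_assoc, h', smul_mul_assoc, mul_assoc, ih,
        mul_smul_comm, smul_smul, List.length_cons, mul_assoc]
      congr 1
      ring
  have h := key I.sort
  rwa [Finset.length_sort] at h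

/-- `P` is the composite of the maps `x ↦ x + e i * x * e i`. Every word is an eigenvector of each
factor, with eigenvalue 2 or 0; the empty word always gives 2, and any other word is killed by some
factor. -/
theorem exists_average (hn : Even n) : ∃ P : Module.End ℂ A,
    P 1 = (2 ^ n : ℂ) • (1 : A) ∧ ∀ I : Finset (Fin n), I ≠ ∅ → P (word e I) = 0 := by
  let N : Fin n → Module.End ℂ A := fun i =>
    1 + LinearMap.mulLeft ℂ (e i) * LinearMap.mulRight ℂ (e i)
  let ε : Finset (Fin n) → Fin n → ℂ := fun I i =>
    1 + (if i ∈ I then -1 else 1) * (-1) ^ I.card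
  have hN : ∀ I i, N i (word e I) = ε I i • word e I := by
    intro I i
    simp only [N, ε, LinearMap.add_apply, Module.End.one_apply, Module.End.mul_apply,
      LinearMap.mulLeft_apply, LinearMap.mulRight_apply, ← mul_assoc, he.conj_word, add_smul,
      one_smul]
  have hP : ∀ I (l : List (Fin n)),
      (l.map N).prod (word e I) = (l.map (ε I)).prod • word e I := by
    intro I l
    induction l with
    | nil => simp
    | cons i l ih =>
      rw [List.map_cons, List.prod_cons, Module.End.mul_apply, ih, map_smul, hN, smul_smul,
        List.map_cons, List.prod_cons, mul_comm]
  refine ⟨((List.finRange n).map N).prod, ?_, ?_⟩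
  · have h := hP ∅ (List.finRange n)
    have hε : ε ∅ = fun _ => 2 := by
      ext i
      norm_num [ε]
    simpa [hε] using h
  · intro I hI
    obtain ⟨i, hi⟩ := exists_conj_sign_eq_neg_one hn hI
    rw [hP, List.prod_eq_zero, zero_smul]
    exact List.mem_map.2 ⟨i, List.mem_finRange i, by simp only [ε, hi, add_neg_cancel]⟩

/-- Multiplying a relation by the word of `J` moves the `J` term, and no other, to the scalars,
where the averaging map isolates its coefficient. Only nontriviality of the algebra enters, so this
also applies to the image of the generators under a representation. -/
theorem linearIndependent_word [Nontrivial A] (hn : Even n) : LinearIndependent ℂ (word e) := by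
  obtain ⟨P, hP, hP'⟩ := he.exists_average hn
  rw [Fintype.linearIndependent_iff]
  intro a ha J
  have h := congrArg P (congrArg (· * word e J) ha)
  simp only [Finset.sum_mul, zero_mul, map_zero, map_sum] at h
  rw [Finset.sum_eq_single J] at h
  · rw [smul_mul_assoc, he.word_mul_self, map_smul, map_smul, hP] at h
    simpa using h
  · intro I _ hIJ
    obtain ⟨c, -, hc⟩ := he.word_mul_word I J
    rw [smul_mul_assoc, hc, map_smul, map_smul, hP', smul_zero, smul_zero]
    simpa using hIJ
  · simp

theorem span_word (h : Algebra.adjoin ℂ (Set.range e) = ⊤) :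
    Submodule.span ℂ (Set.range (word e)) = ⊤ := by
  have key : ∀ x ∈ Algebra.adjoin ℂ (Set.range e),
      ∀ w ∈ Submodule.span ℂ (Set.range (word e)), x * w ∈ Submodule.span ℂ (Set.range (word e)) := by
    intro x hx
    induction hx using Algebra.adjoin_induction with
    | mem x hx =>
      obtain ⟨i, rfl⟩ := hx
      intro w hw
      induction hw using Submodule.span_induction with
      | mem w hw =>
        obtain ⟨I, rfl⟩ := hw
        obtain ⟨c, -, hc⟩ := he.mul_word i I
        rw [hc]
        exact Submodule.smul_mem _ _ (Submodule.subset_span ⟨_, rfl⟩)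
      | zero => simp
      | add x y _ _ hx hy => simpa [mul_add] using add_mem hx hy
      | smul c x _ hx => simpa using Submodule.smul_mem _ c hx
    | algebraMap r =>
      intro w hw
      rw [← Algebra.smul_def]
      exact Submodule.smul_mem _ _ hw
    | add x y _ _ hx hy => intro w hw; simpa [add_mul] using add_mem (hx w hw) (hy w hw)
    | mul x y _ _ hx hy => intro w hw; simpa [mul_assoc] using hx _ (hy w hw)
  rw [eq_top_iff]
  intro x _
  rw [← mul_one x]
  exact key x (by rw [h]; trivial) 1 (Submodule.subset_span ⟨∅, by simp⟩)

/-- The words in a generating Clifford family form a basis. -/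
def basis [Nontrivial A] (hn : Even n) (h : Algebra.adjoin ℂ (Set.range e) = ⊤) :
    Module.Basis (Finset (Fin n)) ℂ A :=
  Module.Basis.mk (he.linearIndependent_word hn) (he.span_word h).ge

/-- Conjugation by an involution preserves the trace, yet some `e i` conjugates a nonempty word to
its negative. -/
theorem trace_word {S : Type*} [AddCommGroup S] [Module ℂ S] (hn : Even n)
    (f : A →ₐ[ℂ] Module.End ℂ S) {I : Finset (Fin n)} (hI : I ≠ ∅) :
    LinearMap.trace ℂ S (f (word e I)) = 0 := by
  obtain ⟨i, hi⟩ := exists_conj_sign_eq_neg_one hn hI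
  have h := he.conj_word i I
  rw [hi] at h
  have h1 : LinearMap.trace ℂ S (f (e i * word e I * e i)) =
      LinearMap.trace ℂ S (f (word e I)) := by
    rw [map_mul, LinearMap.trace_mul_comm, ← map_mul, ← mul_assoc, he.sq, one_mul]
  rw [h, map_smul, map_smul, smul_eq_mul] at h1
  linear_combination (-1 / 2) * h1

end IsCliffordFamily

end Words

/-! ### Burnside's theorem for irreducible modules. -/

section Irreducible

/-- A simple module is cyclic, hence finite-dimensional here; Schur's lemma makes its commutant `ℂ`,
and Jacobson density on a finite basis then reaches every endomorphism. -/
theorem finiteDimensional_and_surjective_of_irreducible {A S : Type*} [Ring A] [Algebra ℂ A]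
    [FiniteDimensional ℂ A] [AddCommGroup S] [Module ℂ S] (γ : A →ₐ[ℂ] Module.End ℂ S)
    (hγ : Representation.IsIrreducible (γ : A →* Module.End ℂ S)) :
    Nontrivial S ∧ FiniteDimensional ℂ S ∧ Function.Surjective γ := by
  let _ : Module A S := Module.compHom S γ.toRingHom
  have smul_eq : ∀ (a : A) (v : S), a • v = γ a v := fun _ _ => rfl
  have : IsScalarTower ℂ A S := ⟨fun c a v => by simp [smul_eq]⟩
  have : Nontrivial S := by
    by_contra h
    rw [not_nontrivial_iff_subsingleton] at h
    obtain ⟨p, q, hpq⟩ := hγ.toNontrivial.exists_pair_ne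
    refine hpq (Subrepresentation.ext (Submodule.ext fun x => ?_))
    rw [Subsingleton.elim x 0]
    simp
  have : IsSimpleModule A S := by
    rw [isSimpleModule_iff]
    refine { eq_bot_or_eq_top := fun N => ?_ }
    let N' : Subrepresentation (γ : A →* Module.End ℂ S) :=
      ⟨N.restrictScalars ℂ, fun a v hv => N.smul_mem a hv⟩
    rcases hγ.eq_bot_or_eq_top N' with h | h
    · left
      ext x
      have : x ∈ N'.toSubmodule ↔ x ∈ (⊥ : Subrepresentation (γ : A →* Module.End ℂ S)).toSubmodule := by rw [h]
      exact this
    · right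
      ext x
      have : x ∈ N'.toSubmodule ↔ x ∈ (⊤ : Subrepresentation (γ : A →* Module.End ℂ S)).toSubmodule := by rw [h]
      exact this
  have : FiniteDimensional ℂ S := by
    obtain ⟨v, hv⟩ := exists_ne (0 : S)
    exact Module.Finite.of_surjective ((LinearMap.toSpanSingleton A S v).restrictScalars ℂ)
      (IsSimpleModule.toSpanSingleton_surjective A hv)
  refine ⟨inferInstance, inferInstance, fun f => ?_⟩
  -- Schur's lemma enters here: the commutant consists of scalars, so any complex-linear `f`
  -- commutes with it.
  let F : Module.End (Module.End A S) S :=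
    { toFun := f
      map_add' := map_add f
      map_smul' := fun g v => by
        obtain ⟨c, rfl⟩ := (IsSimpleModule.algebraMap_end_bijective_of_isAlgClosed (A := A)
          (V := S) ℂ).2 g
        simp }
  classical
  let b := Module.finBasis ℂ S
  obtain ⟨a, ha⟩ := jacobson_density F (Finset.univ.image b)
  exact ⟨a, b.ext fun i => (ha (b i) (by simp)).symm⟩

end Irreducible

/-! ### The orthonormal coframe in the exterior and Clifford algebras. -/

section Coframe

variable {V : Type*} [NormedAddCommGroup V] [InnerProductSpace ℝ V]

variable (hV : Module.finrank ℝ V = 8) (o : Orientation ℝ V (Fin 8))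

/-- The oriented orthonormal coframe used in the definition of the volume form. -/
def coframe (i : Fin 8) : ComplexDual V :=
  (1 : ℂ) ⊗ₜ[ℝ] innerₗ V (o.finOrthonormalBasis (by norm_num) hV i)

theorem span_coframe : Submodule.span ℂ (Set.range (coframe hV o)) = ⊤ := by
  rw [eq_top_iff]
  intro x _
  induction x using TensorProduct.induction_on with
  | zero => exact zero_mem _
  | add x y hx hy => exact add_mem (hx trivial) (hy trivial)
  | tmul z θ =>
    let b := o.finOrthonormalBasis (by norm_num) hV
    have h : θ = ∑ i, θ (b i) • innerₗ V (b i) := by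
      refine LinearMap.ext fun v => ?_
      conv_lhs => rw [← b.sum_repr' v]
      simp [mul_comm]
    have h' : z ⊗ₜ[ℝ] θ = ∑ i, (θ (b i) * z) • coframe hV o i := by
      conv_lhs => rw [h]
      rw [TensorProduct.tmul_sum]
      refine Finset.sum_congr rfl fun i _ => ?_
      simp only [coframe, TensorProduct.smul_tmul', TensorProduct.tmul_smul]
      simp [b]
    rw [h']
    exact sum_mem fun i _ => Submodule.smul_mem _ _ (Submodule.subset_span ⟨i, rfl⟩)

/-- The one-forms of the coframe in the exterior algebra. -/
def exteriorFrame (i : Fin 8) : Forms V := ExteriorAlgebra.ι ℂ (coframe hV o i)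

theorem word_exteriorFrame {k : ℕ} {I : Finset (Fin 8)} (hI : I.card = k) :
    word (exteriorFrame hV o) I =
      exteriorPower.ιMulti ℂ k (coframe hV o ∘ I.orderEmbOfFin hI) := by
  rw [exteriorPower.ιMulti_apply_coe, ExteriorAlgebra.ιMulti_apply, word,
    ← Finset.listMap_orderEmbOfFin_finRange I hI, List.map_map, List.ofFn_eq_map]
  rfl

theorem word_exteriorFrame_mem {k : ℕ} {I : Finset (Fin 8)} (hI : I.card = k) :
    word (exteriorFrame hV o) I ∈ KForms V k := by
  rw [word_exteriorFrame hV o hI]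
  exact Subtype.prop _

theorem word_exteriorFrame_univ : word (exteriorFrame hV o) Finset.univ = volumeForm hV o := by
  rw [word, volumeForm, ExteriorAlgebra.ιMulti_apply, Fin.sort_univ, List.ofFn_eq_map]
  rfl

variable [FiniteDimensional ℝ V]

theorem sharp_innerₗ (v : V) : sharp V (innerₗ V v) = v :=
  ext_inner_right ℝ fun w => by rw [inner_sharp, innerₗ_apply_apply]

theorem complexQuadraticForm_apply (x : ComplexDual V) :
    complexQuadraticForm V x = complexMetric V x x := rfl

theorem polar_complexQuadraticForm (x y : ComplexDual V) :
    QuadraticMap.polar (complexQuadraticForm V) x y = complexMetric V x y + complexMetric V y x :=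
  LinearMap.BilinMap.polar_toQuadraticMap _ _

theorem complexMetric_coframe (i j : Fin 8) :
    complexMetric V (coframe hV o i) (coframe hV o j) = if i = j then 1 else 0 := by
  have h : dualMetric V (innerₗ V (o.finOrthonormalBasis (by norm_num) hV i))
      (innerₗ V (o.finOrthonormalBasis (by norm_num) hV j)) = if i = j then 1 else 0 := by
    simp only [dualMetric, LinearMap.mk₂_apply, sharp_innerₗ]
    exact orthonormal_iff_ite.1 (o.finOrthonormalBasis (by norm_num) hV).orthonormal i j
  rw [coframe, coframe, complexMetric, LinearMap.BilinForm.baseChange_tmul, h]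
  split_ifs <;> simp

/-- The Clifford generators of the coframe. -/
def cliffordFrame (i : Fin 8) : ComplexClifford V :=
  CliffordAlgebra.ι (complexQuadraticForm V) (coframe hV o i)

theorem isCliffordFamily_cliffordFrame : IsCliffordFamily (cliffordFrame hV o) where
  sq i := by
    rw [cliffordFrame, CliffordAlgebra.ι_sq_scalar, complexQuadraticForm_apply, complexMetric_coframe]
    simp
  anticomm i j hij := by
    rw [cliffordFrame, cliffordFrame, eq_neg_iff_add_eq_zero,
      CliffordAlgebra.ι_mul_ι_add_swap, polar_complexQuadraticForm, complexMetric_coframe, complexMetric_coframe]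
    simp [hij, Ne.symm hij]

theorem adjoin_cliffordFrame :
    Algebra.adjoin ℂ (Set.range (cliffordFrame hV o)) = ⊤ := by
  rw [eq_top_iff, ← CliffordAlgebra.adjoin_range_ι, Algebra.adjoin_le_iff]
  rintro _ ⟨x, rfl⟩
  have hx : x ∈ Submodule.span ℂ (Set.range (coframe hV o)) := by
    rw [span_coframe]
    trivial
  induction hx using Submodule.span_induction with
  | mem x hx =>
    obtain ⟨i, rfl⟩ := hx
    exact Algebra.subset_adjoin ⟨i, rfl⟩
  | zero => simp
  | add x y _ _ hx hy => simpa using add_mem hx hy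
  | smul c x _ hx => simpa using Subalgebra.smul_mem _ hx c

theorem contractLeft_prod_map_ι {R M : Type*} [CommRing R] [AddCommGroup M] [Module R M]
    {Q : QuadraticForm R M} (d : Module.Dual R M) (l : List M) (h : ∀ m ∈ l, d m = 0) :
    CliffordAlgebra.contractLeft d (l.map (CliffordAlgebra.ι Q)).prod = 0 := by
  induction l with
  | nil => simp
  | cons m l ih =>
    rw [List.map_cons, List.prod_cons, CliffordAlgebra.contractLeft_ι_mul,
      ih fun x hx => h x (List.mem_cons_of_mem _ hx), h m List.mem_cons_self]
    simp

/-- Left multiplication by a one-form differs in the two algebras by a contraction, which vanishes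
on products of coframe elements orthogonal to it. -/
theorem chevalleyRiesz_prod {l : List (Fin 8)} (hl : l.Nodup) :
    chevalleyRiesz V (l.map (exteriorFrame hV o)).prod = (l.map (cliffordFrame hV o)).prod := by
  let _ : Invertible (2 : ℂ) := invertibleOfNonzero two_ne_zero
  -- `chevalleyRiesz` unfolds to `changeForm` along this bilinear form, so the recursion for
  -- `changeForm` applies definitionally.
  have hB : LinearMap.BilinMap.toQuadraticMap
      (-QuadraticMap.associated (R := ℂ) (-complexQuadraticForm V)) = complexQuadraticForm V - 0 :=
    CliffordAlgebra.changeForm.neg_proof CliffordAlgebra.changeForm.associated_neg_proof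
  induction l with
  | nil =>
    exact CliffordAlgebra.changeForm_one hB
  | cons i l ih =>
    obtain ⟨hi, hl⟩ := List.nodup_cons.1 hl
    specialize ih hl
    rw [List.map_cons, List.prod_cons, List.map_cons, List.prod_cons]
    refine (CliffordAlgebra.changeForm_ι_mul hB _ _).trans ?_
    have ih' : CliffordAlgebra.changeForm hB (l.map (exteriorFrame hV o)).prod = (l.map (cliffordFrame hV o)).prod := ih
    rw [ih']
    have hm : (l.map (cliffordFrame hV o)).prod =
        ((l.map (coframe hV o)).map (CliffordAlgebra.ι (complexQuadraticForm V))).prod := by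
      rw [List.map_map]
      rfl
    rw [hm, contractLeft_prod_map_ι, sub_zero]
    · rfl
    · intro m hm
      obtain ⟨j, hj, rfl⟩ := List.mem_map.1 hm
      have hij : i ≠ j := by
        rintro rfl
        exact hi hj
      have h := polar_complexQuadraticForm (coframe hV o i) (coframe hV o j)
      rw [complexMetric_coframe, complexMetric_coframe, if_neg hij, if_neg hij.symm,
        QuadraticMap.polar] at h
      simp [QuadraticMap.associated_apply, h]

theorem chevalleyRiesz_word (I : Finset (Fin 8)) :
    chevalleyRiesz V (word (exteriorFrame hV o) I) = word (cliffordFrame hV o) I :=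
  chevalleyRiesz_prod hV o (Finset.sort_nodup _ _)

theorem formPairing_word {I J : Finset (Fin 8)} {k : ℕ} (hI : I.card = k) (hJ : J.card = k) :
    formPairing (⟨_, word_exteriorFrame_mem hV o hI⟩ : KForms V k)
      ⟨_, word_exteriorFrame_mem hV o hJ⟩ = if I = J then 1 else 0 := by
  have h (I : Finset (Fin 8)) (hI : I.card = k) :
      (⟨_, word_exteriorFrame_mem hV o hI⟩ : KForms V k) =
      exteriorPower.ιMulti ℂ k (coframe hV o ∘ I.orderEmbOfFin hI) :=
    Subtype.ext (word_exteriorFrame hV o hI)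
  rw [formPairing, h I hI, h J hJ, exteriorPower.map_apply_ιMulti]
  have h1 : ∀ i, complexMetric V (coframe hV o i) (coframe hV o i) = 1 := fun i => by
    simp [complexMetric_coframe]
  have h0 : ∀ ⦃i j⦄, i ≠ j → complexMetric V (coframe hV o i) (coframe hV o j) = 0 :=
    fun i j hij => by simp [complexMetric_coframe, hij]
  split_ifs with hIJ
  · subst hIJ
    exact exteriorPower.pairingDual_apply_apply_eq_one (coframe hV o)
      (fun i => complexMetric V (coframe hV o i)) h1 h0 k _
  · refine exteriorPower.pairingDual_apply_apply_eq_one_zero (coframe hV o)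
      (fun i => complexMetric V (coframe hV o i)) h0 k _ _ fun h => hIJ ?_
    rw [← Finset.coe_inj, ← Finset.range_orderEmbOfFin I hI, ← Finset.range_orderEmbOfFin J hJ, h]

end Coframe

/-! ### Coefficients of words, and how they encode degree, metric and wedge product. -/

section Coefficients

variable {V : Type*} [NormedAddCommGroup V] [InnerProductSpace ℝ V]
variable (hV : Module.finrank ℝ V = 8) (o : Orientation ℝ V (Fin 8))

theorem proj_coe {k : ℕ} (ψ : KForms V k) :
    GradedAlgebra.proj (fun n : ℕ => KForms V n) k (ψ : Forms V) = ψ := by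
  rw [GradedAlgebra.proj_apply]
  exact DirectSum.decompose_of_mem_same _ ψ.2

theorem prod_exteriorFrame_mul_eq_zero {i : Fin 8} {l l' : List (Fin 8)} (hl : i ∈ l)
    (hl' : i ∈ l') :
    (l.map (exteriorFrame hV o)).prod * (l'.map (exteriorFrame hV o)).prod = 0 := by
  have key : ∀ l : List (Fin 8), i ∈ l →
      exteriorFrame hV o i * (l.map (exteriorFrame hV o)).prod = 0 := by
    intro l hl
    induction l with
    | nil => simp at hl
    | cons j l ih =>
      rw [List.map_cons, List.prod_cons, ← mul_assoc]
      by_cases hij : i = j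
      · rw [hij, exteriorFrame, ExteriorAlgebra.ι_sq_zero, zero_mul]
      · have h := ExteriorAlgebra.ι_add_mul_swap (R := ℂ) (coframe hV o i) (coframe hV o j)
        rw [← eq_neg_iff_add_eq_zero] at h
        rw [exteriorFrame, exteriorFrame, h, neg_mul, mul_assoc]
        rw [← exteriorFrame, ← exteriorFrame, ih ((List.mem_cons.1 hl).resolve_left hij), mul_zero,
          neg_zero]
  induction l with
  | nil => simp at hl
  | cons j l ih =>
    rw [List.map_cons, List.prod_cons, mul_assoc]
    by_cases hj : i ∈ l
    · rw [ih hj, mul_zero]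
    · obtain rfl : i = j := (List.mem_cons.1 hl).resolve_right hj
      have h := key (l ++ l') (List.mem_append_right l hl')
      rwa [List.map_append, List.prod_append] at h

variable [FiniteDimensional ℝ V]

instance : Nontrivial (ComplexClifford V) := (chevalleyRiesz V).injective.nontrivial

/-- The basis of the Clifford algebra by ordered products of an orthonormal coframe. -/
def cliffordBasis : Module.Basis (Finset (Fin 8)) ℂ (ComplexClifford V) :=
  (isCliffordFamily_cliffordFrame hV o).basis (by decide) (adjoin_cliffordFrame hV o)

/-- The ordered product of the coframe elements with index in `I`, in the Clifford algebra. -/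
abbrev cword (I : Finset (Fin 8)) : ComplexClifford V := word (cliffordFrame hV o) I

@[simp] theorem cliffordBasis_apply (I : Finset (Fin 8)) :
    cliffordBasis hV o I = cword hV o I := by
  simp [cliffordBasis, IsCliffordFamily.basis]

/-- The coefficients of an element of the Clifford algebra in the basis of ordered products. -/
def coeff (I : Finset (Fin 8)) : ComplexClifford V →ₗ[ℂ] ℂ := (cliffordBasis hV o).coord I

theorem coeff_cword (I J : Finset (Fin 8)) :
    coeff hV o I (cword hV o J) = if J = I then 1 else 0 := by
  rw [coeff, ← cliffordBasis_apply, Module.Basis.coord_apply, Module.Basis.repr_self,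
    Finsupp.single_apply]

theorem coeff_ext {x y : ComplexClifford V} (h : ∀ I, coeff hV o I x = coeff hV o I y) : x = y :=
  (cliffordBasis hV o).ext_elem h

variable {hV o} in
theorem linearMap_ext_cword {M : Type*} [AddCommGroup M] [Module ℂ M]
    {f g : ComplexClifford V →ₗ[ℂ] M} (h : ∀ I, f (cword hV o I) = g (cword hV o I)) : f = g :=
  (cliffordBasis hV o).ext fun I => by simpa using h I

theorem coeff_one (I : Finset (Fin 8)) : coeff hV o I 1 = if I = ∅ then 1 else 0 := by
  rw [← word_empty (e := cliffordFrame hV o), coeff_cword]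
  simp only [eq_comm]

theorem reverse_cword (I : Finset (Fin 8)) :
    CliffordAlgebra.reverse (cword hV o I) = ((-1) ^ I.card.choose 2 : ℂ) • cword hV o I := by
  have h := CliffordAlgebra.reverse_prod_map_ι (Q := complexQuadraticForm V)
    (I.sort.map (coframe hV o))
  rw [← List.map_reverse, ← List.map_reverse, List.map_map, List.map_map] at h
  have h' := (isCliffordFamily_cliffordFrame hV o).reverse_prod (Finset.sort_nodup I (· ≤ ·))
  rw [Finset.length_sort] at h'
  exact h.trans h'

theorem coeff_reverse (I : Finset (Fin 8)) (z : ComplexClifford V) :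
    coeff hV o I (CliffordAlgebra.reverse z) = (-1) ^ I.card.choose 2 * coeff hV o I z := by
  have h : coeff hV o I ∘ₗ CliffordAlgebra.reverse =
      ((-1) ^ I.card.choose 2 : ℂ) • coeff hV o I := by
    refine linearMap_ext_cword (hV := hV) (o := o) fun J => ?_
    rw [LinearMap.comp_apply, reverse_cword, map_smul, LinearMap.smul_apply, coeff_cword]
    split_ifs with hJ
    · rw [hJ]
    · simp
  exact LinearMap.congr_fun h z

theorem cword_univ_mul_self : cword hV o Finset.univ * cword hV o Finset.univ = 1 := by
  rw [(isCliffordFamily_cliffordFrame hV o).word_mul_self, Finset.card_univ, Fintype.card_fin,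
    show (8 : ℕ).choose 2 = 28 by decide]
  norm_num

theorem coeff_univ_mul_mul_univ (I : Finset (Fin 8)) (z : ComplexClifford V) :
    coeff hV o I (cword hV o Finset.univ * z * cword hV o Finset.univ) =
      (-1) ^ I.card * coeff hV o I z := by
  have h : coeff hV o I ∘ₗ LinearMap.mulRight ℂ (cword hV o Finset.univ) ∘ₗ
      LinearMap.mulLeft ℂ (cword hV o Finset.univ) = ((-1) ^ I.card : ℂ) • coeff hV o I := by
    refine linearMap_ext_cword (hV := hV) (o := o) fun J => ?_
    rw [LinearMap.comp_apply, LinearMap.comp_apply, LinearMap.mulLeft_apply,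
      LinearMap.mulRight_apply,
      (isCliffordFamily_cliffordFrame hV o).word_univ_mul_word (by decide), smul_mul_assoc,
      mul_assoc, cword_univ_mul_self, mul_one, map_smul, LinearMap.smul_apply, coeff_cword]
    split_ifs with hJ
    · rw [hJ]
    · simp
  exact LinearMap.congr_fun h z

/-- A product of two words is scalar only if the words coincide, so the scalar part of products
reads off every coefficient, up to the sign of the square of a word. -/
theorem coeff_empty_cword_mul (I : Finset (Fin 8)) (z : ComplexClifford V) :
    coeff hV o ∅ (cword hV o I * z) = (-1) ^ I.card.choose 2 * coeff hV o I z := by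
  have h : coeff hV o ∅ ∘ₗ LinearMap.mulLeft ℂ (cword hV o I) =
      ((-1) ^ I.card.choose 2 : ℂ) • coeff hV o I := by
    refine linearMap_ext_cword (hV := hV) (o := o) fun J => ?_
    rw [LinearMap.comp_apply, LinearMap.mulLeft_apply, LinearMap.smul_apply, coeff_cword]
    split_ifs with hJ
    · rw [hJ, (isCliffordFamily_cliffordFrame hV o).word_mul_self, map_smul, coeff_one, if_pos rfl]
    · obtain ⟨c, -, hc⟩ := (isCliffordFamily_cliffordFrame hV o).word_mul_word I J
      rw [hc, map_smul, coeff_cword, if_neg (by simpa [eq_comm] using hJ), smul_zero, smul_zero]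
  exact LinearMap.congr_fun h z

theorem coeff_empty_cword_univ_mul (z : ComplexClifford V) :
    coeff hV o ∅ (cword hV o Finset.univ * z) = coeff hV o Finset.univ z := by
  rw [coeff_empty_cword_mul, Finset.card_univ, Fintype.card_fin,
    show (8 : ℕ).choose 2 = 28 by decide]
  norm_num

theorem proj_chevalleyRiesz_symm_cword (k : ℕ) (I : Finset (Fin 8)) :
    GradedAlgebra.proj (fun n : ℕ => KForms V n) k ((chevalleyRiesz V).symm (cword hV o I)) =
      if I.card = k then (chevalleyRiesz V).symm (cword hV o I) else 0 := by
  rw [cword, ← chevalleyRiesz_word, LinearEquiv.symm_apply_apply, GradedAlgebra.proj_apply]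
  split_ifs with h
  · exact DirectSum.decompose_of_mem_same _ (word_exteriorFrame_mem hV o h)
  · exact DirectSum.decompose_of_mem_ne _ (word_exteriorFrame_mem hV o rfl) h

theorem coeff_proj (k : ℕ) (I : Finset (Fin 8)) (z : ComplexClifford V) :
    coeff hV o I (chevalleyRiesz V
      (GradedAlgebra.proj (fun n : ℕ => KForms V n) k ((chevalleyRiesz V).symm z))) =
      if I.card = k then coeff hV o I z else 0 := by
  have h : coeff hV o I ∘ₗ (chevalleyRiesz V).toLinearMap ∘ₗ
      GradedAlgebra.proj (fun n : ℕ => KForms V n) k ∘ₗ (chevalleyRiesz V).symm.toLinearMap =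
      if I.card = k then coeff hV o I else 0 := by
    refine linearMap_ext_cword (hV := hV) (o := o) fun J => ?_
    simp only [LinearMap.comp_apply, LinearEquiv.coe_coe, proj_chevalleyRiesz_symm_cword]
    by_cases hJ : J.card = k
    · rw [if_pos hJ, LinearEquiv.apply_symm_apply]
      split_ifs with hI
      · rfl
      · rw [coeff_cword, if_neg (by rintro rfl; exact hI hJ), LinearMap.zero_apply]
    · rw [if_neg hJ, map_zero, map_zero]
      split_ifs with hI
      · rw [coeff_cword, if_neg (by rintro rfl; exact hJ hI)]
      · rfl
  have h' := LinearMap.congr_fun h z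
  simp only [LinearMap.comp_apply, LinearEquiv.coe_coe] at h'
  rw [h']
  split_ifs <;> rfl

theorem coeff_eq_zero_of_card_ne {k : ℕ} (ψ : KForms V k) {I : Finset (Fin 8)} (hI : I.card ≠ k) :
    coeff hV o I (chevalleyRiesz V ψ) = 0 := by
  have h := coeff_proj hV o k I (chevalleyRiesz V ψ)
  rwa [LinearEquiv.symm_apply_apply, proj_coe, if_neg hI] at h

theorem sum_coeff_smul_cword (z : ComplexClifford V) :
    ∑ I, coeff hV o I z • cword hV o I = z := by
  simpa [coeff] using (cliffordBasis hV o).sum_repr z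

theorem span_kforms (k : ℕ) :
    Submodule.span ℂ (Set.range fun I : {I : Finset (Fin 8) // I.card = k} =>
      (⟨_, word_exteriorFrame_mem hV o I.2⟩ : KForms V k)) = ⊤ := by
  rw [eq_top_iff]
  intro ψ _
  have h : ψ = ∑ I : {I : Finset (Fin 8) // I.card = k}, coeff hV o I (chevalleyRiesz V ψ) •
      (⟨_, word_exteriorFrame_mem hV o I.2⟩ : KForms V k) := by
    refine Subtype.ext ((chevalleyRiesz V).injective (coeff_ext hV o fun J => ?_))
    simp only [Submodule.coe_sum, Submodule.coe_smul, map_sum, map_smul, chevalleyRiesz_word,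
      coeff_cword, smul_eq_mul, mul_ite, mul_one, mul_zero]
    by_cases hJ : J.card = k
    · rw [Finset.sum_eq_single ⟨J, hJ⟩]
      · simp
      · rintro ⟨I, hI⟩ _ hIJ
        rw [if_neg]
        simpa using hIJ
      · simp
    · rw [coeff_eq_zero_of_card_ne hV o ψ hJ, Finset.sum_eq_zero]
      rintro ⟨I, hI⟩ _
      rw [if_neg]
      rintro rfl
      exact hJ hI
  rw [h]
  exact sum_mem fun I _ => Submodule.smul_mem _ _ (Submodule.subset_span ⟨I, rfl⟩)

theorem bilinear_ext_kforms {k l : ℕ} {M : Type*} [AddCommGroup M] [Module ℂ M]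
    {f g : KForms V k →ₗ[ℂ] KForms V l →ₗ[ℂ] M}
    (h : ∀ (I J : Finset (Fin 8)) (hI : I.card = k) (hJ : J.card = l),
      f ⟨_, word_exteriorFrame_mem hV o hI⟩ ⟨_, word_exteriorFrame_mem hV o hJ⟩ =
        g ⟨_, word_exteriorFrame_mem hV o hI⟩ ⟨_, word_exteriorFrame_mem hV o hJ⟩) : f = g := by
  refine LinearMap.ext_on (span_kforms hV o k) ?_
  rintro _ ⟨I, rfl⟩
  refine LinearMap.ext_on (span_kforms hV o l) ?_
  rintro _ ⟨J, rfl⟩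
  exact h I J I.2 J.2

/-- The map `(ψ, χ) ↦ ψ ⋄ χ` into the Clifford algebra. -/
def cliffordMulForms (k l : ℕ) : KForms V k →ₗ[ℂ] KForms V l →ₗ[ℂ] ComplexClifford V :=
  (LinearMap.mul ℂ (ComplexClifford V)).compl₁₂
    ((chevalleyRiesz V).toLinearMap ∘ₗ (KForms V k).subtype)
    ((chevalleyRiesz V).toLinearMap ∘ₗ (KForms V l).subtype)

theorem cliffordMulForms_apply {k l : ℕ} (ψ : KForms V k) (χ : KForms V l) :
    cliffordMulForms k l ψ χ = chevalleyRiesz V ψ * chevalleyRiesz V χ := rfl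

theorem coeff_empty_mul (ψ χ : KForms V 4) :
    coeff hV o ∅ (chevalleyRiesz V ψ * chevalleyRiesz V χ) = formPairing ψ χ := by
  have h : (cliffordMulForms 4 4).compr₂ (coeff hV o ∅) =
      exteriorPower.pairingDual ℂ (ComplexDual V) 4 ∘ₗ
        exteriorPower.map 4 (complexMetric V) := by
    refine bilinear_ext_kforms hV o fun I J hI hJ => ?_
    refine Eq.trans ?_ (formPairing_word hV o hI hJ).symm
    rw [LinearMap.compr₂_apply, cliffordMulForms_apply, chevalleyRiesz_word, chevalleyRiesz_word,
      coeff_empty_cword_mul, coeff_cword, hI, show (4 : ℕ).choose 2 = 6 by decide]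
    norm_num [eq_comm]
  exact LinearMap.congr_fun₂ h ψ χ

/-- For disjoint index sets the exterior and Clifford products correspond. For overlapping ones the
wedge product vanishes and the Clifford product misses the top degree. -/
theorem mul_eq_smul_volumeForm (ψ χ : KForms V 4) :
    (ψ : Forms V) * (χ : Forms V) =
      coeff hV o Finset.univ (chevalleyRiesz V ψ * chevalleyRiesz V χ) • volumeForm hV o := by
  have h : (LinearMap.mul ℂ (Forms V)).compl₁₂ (KForms V 4).subtype (KForms V 4).subtype =
      (cliffordMulForms 4 4).compr₂ ((coeff hV o Finset.univ).smulRight (volumeForm hV o)) := by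
    refine bilinear_ext_kforms hV o fun I J hI hJ => ?_
    rw [LinearMap.compr₂_apply, cliffordMulForms_apply, LinearMap.smulRight_apply,
      LinearMap.compl₁₂_apply, LinearMap.mul_apply', Submodule.subtype_apply,
      Submodule.subtype_apply, chevalleyRiesz_word, chevalleyRiesz_word]
    obtain ⟨c, -, hc⟩ := (isCliffordFamily_cliffordFrame hV o).word_mul_word I J
    rw [hc, map_smul, coeff_cword]
    by_cases hd : Disjoint I J
    · have hu : I ∆ J = Finset.univ := by
        rw [hd.symmDiff_eq_sup, ← Finset.card_eq_iff_eq_univ, Finset.sup_eq_union,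
          Finset.card_union_of_disjoint hd, hI, hJ, Fintype.card_fin]
      rw [if_pos hu, smul_eq_mul, mul_one, ← word_exteriorFrame_univ]
      apply (chevalleyRiesz V).injective
      rw [map_smul, chevalleyRiesz_word, ← hu, ← hc]
      have h := chevalleyRiesz_prod hV o (l := I.sort ++ J.sort) (by
        rw [List.nodup_append']
        refine ⟨Finset.sort_nodup _ _, Finset.sort_nodup _ _, fun i hi hj => ?_⟩
        rw [Finset.mem_sort] at hi hj
        exact Finset.disjoint_left.1 hd hi hj)
      rwa [List.map_append, List.prod_append, List.map_append, List.prod_append] at h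
    · obtain ⟨i, hi, hj⟩ := Finset.not_disjoint_iff.1 hd
      have hu : I ∆ J ≠ Finset.univ := fun h => by
        have := Finset.mem_univ i
        rw [← h, Finset.mem_symmDiff] at this
        tauto
      rw [if_neg hu, smul_zero, zero_smul]
      exact prod_exteriorFrame_mul_eq_zero hV o (i := i) (by simpa using hi) (by simpa using hj)
  exact LinearMap.congr_fun₂ h ψ χ

end Coefficients

/-! ### Self-duality and reversion as Clifford identities. -/

section SelfDual

variable {V : Type*} [NormedAddCommGroup V] [InnerProductSpace ℝ V] [FiniteDimensional ℝ V]
variable (hV : Module.finrank ℝ V = 8) (o : Orientation ℝ V (Fin 8))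

/-- The volume form as an element of the Clifford algebra. -/
abbrev cliffordVolume : ComplexClifford V := cword hV o Finset.univ

theorem chevalleyRiesz_volumeForm : chevalleyRiesz V (volumeForm hV o) = cliffordVolume hV o := by
  rw [← word_exteriorFrame_univ, chevalleyRiesz_word]

include hV o in
theorem chevalleyRiesz_algebraMap (c : ℂ) :
    chevalleyRiesz V (algebraMap ℂ (Forms V) c) = c • (1 : ComplexClifford V) := by
  have h := chevalleyRiesz_word hV o ∅
  rw [word_empty, word_empty] at h
  rw [Algebra.algebraMap_eq_smul_one, map_smul, h]

theorem volumeForm_ne_zero : volumeForm hV o ≠ 0 := by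
  intro h
  have h1 := chevalleyRiesz_volumeForm hV o
  have h2 := cword_univ_mul_self hV o
  rw [h, map_zero] at h1
  rw [← cliffordVolume, ← h1, zero_mul] at h2
  exact zero_ne_one h2

theorem commute_volume_of_coeff {z : ComplexClifford V}
    (h : ∀ I : Finset (Fin 8), Odd I.card → coeff hV o I z = 0) :
    cliffordVolume hV o * z = z * cliffordVolume hV o := by
  have h1 : cliffordVolume hV o * z * cliffordVolume hV o = z := by
    refine coeff_ext hV o fun I => ?_
    rw [coeff_univ_mul_mul_univ]
    rcases Nat.even_or_odd I.card with hI | hI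
    · rw [hI.neg_one_pow, one_mul]
    · rw [h I hI, mul_zero]
  conv_rhs => rw [← h1, mul_assoc, cword_univ_mul_self, mul_one]

theorem commute_volume (X : KForms V 4) :
    cliffordVolume hV o * chevalleyRiesz V X = chevalleyRiesz V X * cliffordVolume hV o := by
  refine commute_volume_of_coeff hV o fun I hI => coeff_eq_zero_of_card_ne hV o X fun h => ?_
  rw [h] at hI
  exact absurd hI (by decide)

include hV o in
theorem reverse_chevalleyRiesz (X : KForms V 4) :
    CliffordAlgebra.reverse (chevalleyRiesz V (X : Forms V)) = chevalleyRiesz V (X : Forms V) := by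
  refine coeff_ext hV o fun I => ?_
  rw [coeff_reverse]
  by_cases hI : I.card = 4
  · rw [hI, show (4 : ℕ).choose 2 = 6 by decide]
    norm_num
  · rw [coeff_eq_zero_of_card_ne hV o X hI, mul_zero]

theorem coeff_mul_volume_eq_zero (X : KForms V 4) {I : Finset (Fin 8)} (hI : I.card ≠ 4) :
    coeff hV o I (chevalleyRiesz V X * cliffordVolume hV o) = 0 := by
  conv_lhs => rw [← sum_coeff_smul_cword hV o (chevalleyRiesz V X)]
  rw [Finset.sum_mul, map_sum, Finset.sum_eq_zero]
  intro J _
  by_cases hJ : J.card = 4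
  · obtain ⟨c, -, hc⟩ := (isCliffordFamily_cliffordFrame hV o).word_mul_word J Finset.univ
    rw [smul_mul_assoc, hc, map_smul, map_smul, coeff_cword, if_neg, smul_zero, smul_zero]
    rintro rfl
    apply hI
    rw [← Finset.top_eq_univ, symmDiff_top, hnot_eq_compl, Finset.card_compl, hJ,
      Fintype.card_fin]
  · rw [coeff_eq_zero_of_card_ne hV o X hJ, zero_smul, zero_mul, map_zero]

/-- The top coefficient of a product is the scalar part after multiplication by the volume element,
which commutes with four-forms. Testing against the words of length four then compares coefficients
one by one. -/
theorem isHodgeDual_smul_iff (X : KForms V 4) (m : ℂ) :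
    IsHodgeDual hV o X (m • X) ↔
      m • (cliffordVolume hV o * chevalleyRiesz V X) = chevalleyRiesz V X := by
  have h (ψ : KForms V 4) : (ψ : Forms V) * ((m • X : KForms V 4) : Forms V) =
      coeff hV o ∅ (chevalleyRiesz V ψ *
        m • (cliffordVolume hV o * chevalleyRiesz V X)) • volumeForm hV o := by
    rw [mul_eq_smul_volumeForm hV o, ← coeff_empty_cword_univ_mul, Submodule.coe_smul, map_smul,
      ← mul_assoc, commute_volume, mul_assoc, mul_smul_comm, mul_smul_comm]
  constructor
  · intro hX
    refine coeff_ext hV o fun I => ?_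
    by_cases hI : I.card = 4
    · have h1 := hX ⟨_, word_exteriorFrame_mem hV o hI⟩
      rw [h, ← coeff_empty_mul hV o] at h1
      have h2 := smul_left_injective ℂ (volumeForm_ne_zero hV o) h1
      rw [chevalleyRiesz_word, coeff_empty_cword_mul, coeff_empty_cword_mul] at h2
      exact mul_left_cancel₀ (pow_ne_zero _ (by norm_num)) h2
    · rw [map_smul, commute_volume, coeff_mul_volume_eq_zero hV o X hI,
        coeff_eq_zero_of_card_ne hV o X hI, smul_zero]
  · intro hX ψ
    rw [h, hX, coeff_empty_mul]

/-- The component of degree four of an element of the Clifford algebra. -/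
def fourPart (z : ComplexClifford V) : KForms V 4 :=
  DirectSum.decompose (fun n : ℕ => KForms V n) ((chevalleyRiesz V).symm z) 4

theorem coe_fourPart (z : ComplexClifford V) :
    (fourPart z : Forms V) =
      GradedAlgebra.proj (fun n : ℕ => KForms V n) 4 ((chevalleyRiesz V).symm z) := by
  rw [GradedAlgebra.proj_apply, fourPart]

theorem coeff_fourPart (I : Finset (Fin 8)) (z : ComplexClifford V) :
    coeff hV o I (chevalleyRiesz V (fourPart z)) = if I.card = 4 then coeff hV o I z else 0 := by
  rw [coe_fourPart, coeff_proj]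

/-- Reversion acts on degree `k` by `(-1) ^ k.choose 2`, conjugation by the volume element by `(-1)
^ k`; both signs are trivial only for `k = 0, 4, 8`. -/
theorem eq_add_fourPart_add {z : ComplexClifford V} (hr : CliffordAlgebra.reverse z = z)
    (hc : cliffordVolume hV o * z = z * cliffordVolume hV o) :
    z = coeff hV o ∅ z • 1 + chevalleyRiesz V (fourPart z) +
      coeff hV o Finset.univ z • cliffordVolume hV o := by
  refine coeff_ext hV o fun I => ?_
  rw [map_add, map_add, map_smul, map_smul, coeff_one, coeff_fourPart, coeff_cword]
  have h1 := coeff_reverse hV o I z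
  have h2 := coeff_univ_mul_mul_univ hV o I z
  rw [hr] at h1
  rw [hc, mul_assoc, cword_univ_mul_self, mul_one] at h2
  rcases eq_or_ne I ∅ with rfl | h0
  · simp [Finset.univ_eq_empty_iff]
  rcases eq_or_ne I Finset.univ with rfl | h8
  · simp [Finset.univ_eq_empty_iff]
  rw [if_neg h0, if_neg h8.symm, smul_zero, smul_zero, zero_add, add_zero]
  split_ifs with h4
  · rfl
  have hlt : I.card < 8 := by simpa using (Finset.card_lt_iff_ne_univ I).2 h8
  have hpos : 0 < I.card := Finset.card_pos.2 (Finset.nonempty_iff_ne_empty.2 h0)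
  have hsign : ∀ k : ℕ, k < 8 → 0 < k → k ≠ 4 → Odd (k.choose 2) ∨ Odd k := by decide
  rcases hsign _ hlt hpos h4 with h | h
  · rw [h.neg_one_pow] at h1
    linear_combination (1 / 2) * h1
  · rw [h.neg_one_pow] at h2
    linear_combination (1 / 2) * h2

end SelfDual

/-! ### The quadratic relation for the square and for its four-form part. -/

section Relations

variable {A : Type*} [Ring A] [Algebra ℂ A] {m c : ℂ} {N W Z : A}

/-- Expanding the square of `Z - c - m c N` gives `(16 - 4) c Z + 2 c² (1 + m N)`; substituting for
`Z` produces the constants 12 and `14 = 12 + 2`. -/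
theorem mul_self_of_square_relation (hm : m * m = 1) (hN : N * N = 1) (hNZ : N * Z = m • Z)
    (hZN : Z * N = m • Z) (hZ : Z * Z = (16 * c) • Z) (h : Z = c • 1 + W + (m * c) • N) :
    W * W = (14 * c ^ 2) • 1 + (14 * c ^ 2 * m) • N + (12 * c) • W := by
  have hW : W = Z - c • 1 - (m * c) • N := by rw [h]; abel
  rw [hW]
  simp only [sub_mul, mul_sub, smul_mul_assoc, mul_smul_comm, one_mul, mul_one, hN, hNZ, hZN, hZ]
  match_scalars
  · linear_combination (-2 * c) * hm
  · linear_combination c ^ 2 * hm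
  · ring

theorem square_relation_of_mul_self (hm : m * m = 1) (hN : N * N = 1) (hNW : N * W = m • W)
    (hWN : W * N = m • W)
    (hW : W * W = (14 * c ^ 2) • 1 + (14 * c ^ 2 * m) • N + (12 * c) • W) :
    (c • 1 + W + (m * c) • N) * (c • 1 + W + (m * c) • N) =
      (16 * c) • (c • 1 + W + (m * c) • N) := by
  simp only [add_mul, mul_add, smul_mul_assoc, mul_smul_comm, one_mul, mul_one, hN, hNW, hWN, hW]
  match_scalars <;> first
    | ring1
    | linear_combination c ^ 2 * hm
    | linear_combination (2 * c) * hm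

end Relations

/-! ### The conditions on the four-form as one Clifford equation. -/

section SquareConditions

variable {V : Type*} [NormedAddCommGroup V] [InnerProductSpace ℝ V] [FiniteDimensional ℝ V]
variable (hV : Module.finrank ℝ V = 8) (o : Orientation ℝ V (Fin 8))

/-- The sign exponent is `3 + 8 = 11`, which is odd. -/
theorem generalizedProduct_two (Ω : KForms V 4) :
    generalizedProduct 2 Ω Ω =
      -(fourPart (chevalleyRiesz V (Ω : Forms V) * chevalleyRiesz V Ω) : Forms V) := by
  rw [generalizedProduct, if_pos (by norm_num), coe_fourPart, geometricProduct,
    show (2 + 1 : ℕ).choose 2 + 4 * 2 = 11 by decide, show 4 + 4 - 2 * 2 = 4 by norm_num]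
  norm_num

theorem coeff_volume_of_chiral {z : ComplexClifford V} {m : ℂ}
    (h : cliffordVolume hV o * z = m • z) :
    coeff hV o Finset.univ z = m * coeff hV o ∅ z := by
  rw [← coeff_empty_cword_univ_mul, h, map_smul, smul_eq_mul]

theorem coe_sqrt_fourteen_sq : ((√14 : ℝ) : ℂ) ^ 2 = 14 := by
  rw [← Complex.ofReal_pow, Real.sq_sqrt (by norm_num)]
  norm_num

theorem coe_sqrt_fourteen_ne_zero : ((√14 : ℝ) : ℂ) ≠ 0 := by
  rw [Complex.ofReal_ne_zero]
  positivity

theorem intUnit_mul_self (μ : ℤˣ) : ((μ : ℤ) : ℂ) * ((μ : ℤ) : ℂ) = 1 := by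
  rw [← Int.cast_mul, ← Units.val_mul, Int.units_mul_self, Units.val_one, Int.cast_one]

/-- The square of a four-form is reversion-invariant and commutes with the volume element, so it
lives in degrees 0, 4 and 8. These parts give the root condition, the quadratic condition, and a
consequence of self-duality. Writing the root as `√14 c` makes `c` the scalar coefficient of the
square. -/
theorem squareConditions_iff (μ : ℤˣ) (Ω : KForms V 4) (c : ℂ) :
    SquareConditions hV o μ Ω (((√14 : ℝ) : ℂ) * c) ↔
      cliffordVolume hV o * chevalleyRiesz V Ω = ((μ : ℤ) : ℂ) • chevalleyRiesz V Ω ∧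
      chevalleyRiesz V Ω * chevalleyRiesz V Ω = (14 * c ^ 2) • 1 +
        (14 * c ^ 2 * ((μ : ℤ) : ℂ)) • cliffordVolume hV o + (12 * c) • chevalleyRiesz V Ω := by
  have hμ := intUnit_mul_self μ
  generalize hm : ((μ : ℤ) : ℂ) = m at *
  have hs := coe_sqrt_fourteen_sq
  have hdual : IsHodgeDual hV o Ω (m • Ω) ↔
      cliffordVolume hV o * chevalleyRiesz V Ω = m • chevalleyRiesz V Ω := by
    rw [isHodgeDual_smul_iff]
    constructor
    · intro h
      conv_rhs => rw [← h, smul_smul, hμ, one_smul]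
    · intro h
      rw [h, smul_smul, hμ, one_smul]
  have hquad : ((√14 : ℝ) : ℂ) • generalizedProduct 2 Ω Ω +
      (12 * (((√14 : ℝ) : ℂ) * c)) • (Ω : Forms V) = 0 ↔
      fourPart (chevalleyRiesz V (Ω : Forms V) * chevalleyRiesz V Ω) = (12 * c) • Ω := by
    rw [generalizedProduct_two, show 12 * (((√14 : ℝ) : ℂ) * c) = ((√14 : ℝ) : ℂ) * (12 * c) by ring,
      mul_smul, ← smul_add, smul_eq_zero, or_iff_right coe_sqrt_fourteen_ne_zero,
      neg_add_eq_zero, ← Submodule.coe_smul, Subtype.coe_inj]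
  constructor
  · rintro ⟨h1, h2, h3⟩
    rw [hm, hdual] at h2
    rw [hquad] at h3
    refine ⟨h2, ?_⟩
    have hr : CliffordAlgebra.reverse (chevalleyRiesz V (Ω : Forms V) * chevalleyRiesz V Ω) =
        chevalleyRiesz V (Ω : Forms V) * chevalleyRiesz V Ω := by
      rw [CliffordAlgebra.reverse.map_mul, reverse_chevalleyRiesz hV o]
    have hc := commute_volume hV o Ω
    have h4 : cliffordVolume hV o * (chevalleyRiesz V (Ω : Forms V) * chevalleyRiesz V Ω) =
        m • (chevalleyRiesz V (Ω : Forms V) * chevalleyRiesz V Ω) := by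
      rw [← mul_assoc, h2, smul_mul_assoc]
    have h5 := eq_add_fourPart_add hV o hr (by rw [← mul_assoc, hc, mul_assoc, hc, mul_assoc])
    have h6 : coeff hV o ∅ (chevalleyRiesz V (Ω : Forms V) * chevalleyRiesz V Ω) = 14 * c ^ 2 := by
      rw [coeff_empty_mul, ← h1, mul_pow, hs]
    rw [h3, coeff_volume_of_chiral hV o h4, h6, Submodule.coe_smul, map_smul] at h5
    rw [h5]
    module
  · rintro ⟨h1, h2⟩
    refine ⟨?_, by rwa [hm, hdual], hquad.2 ?_⟩
    · rw [← coeff_empty_mul hV o, h2, map_add, map_add, map_smul, map_smul, map_smul, coeff_one,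
        coeff_cword, coeff_eq_zero_of_card_ne hV o Ω (by simp), mul_pow, hs]
      simp [Finset.univ_eq_empty_iff]
    · refine Subtype.ext ((chevalleyRiesz V).injective (coeff_ext hV o fun I => ?_))
      rw [coeff_fourPart, Submodule.coe_smul, map_smul]
      split_ifs with hI
      · rw [h2, map_add, map_add, map_smul, map_smul, coeff_one, coeff_cword, if_neg, if_neg,
          smul_zero, smul_zero, zero_add, zero_add]
        · rintro rfl
          simp at hI
        · rintro rfl
          simp at hI
      · rw [map_smul, coeff_eq_zero_of_card_ne hV o Ω hI, smul_zero]

end SquareConditions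

/-! ### Rank-one endomorphisms and the irreducible Clifford module. -/

section Spinors

variable {V : Type*} [NormedAddCommGroup V] [InnerProductSpace ℝ V] [FiniteDimensional ℝ V]
variable {S : Type*} [AddCommGroup S] [Module ℂ S]

theorem squareEnd_apply (B : LinearMap.BilinForm ℂ S) (η χ : S) :
    squareEnd B η χ = B χ η • η := rfl

theorem trace_squareEnd [FiniteDimensional ℂ S] (B : LinearMap.BilinForm ℂ S) (η : S) :
    LinearMap.trace ℂ S (squareEnd B η) = B η η := by
  rw [squareEnd, LinearMap.trace_smulRight]
  rfl

theorem squareEnd_mul_self (B : LinearMap.BilinForm ℂ S) (η : S) :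
    squareEnd B η * squareEnd B η = B η η • squareEnd B η := by
  refine LinearMap.ext fun χ => ?_
  simp only [Module.End.mul_apply, squareEnd_apply, map_smul, LinearMap.smul_apply]
  rw [smul_comm]

/-- An idempotent has rank equal to its trace, so `T` has the form `χ ↦ f χ • v`. Self-adjointness
makes `f` proportional to pairing with `v`, and a complex square root of the factor is absorbed into
`v`. -/
theorem exists_eq_squareEnd [FiniteDimensional ℂ S] {B : LinearMap.BilinForm ℂ S}
    (hB : B.Nondegenerate) (hsymm : ∀ ξ χ, B ξ χ = B χ ξ) {T : Module.End ℂ S} {a : ℂ}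
    (ha : a ≠ 0) (hT : T * T = a • T) (htr : LinearMap.trace ℂ S T = a)
    (hadj : ∀ ξ χ, B (T ξ) χ = B ξ (T χ)) : ∃ η, T = squareEnd B η := by
  have hP : IsIdempotentElem (a⁻¹ • T) := by
    rw [IsIdempotentElem, smul_mul_smul_comm, hT, smul_smul, mul_assoc, inv_mul_cancel₀ ha,
      mul_one]
  have hrank : Module.finrank ℂ (LinearMap.range (a⁻¹ • T)) = 1 := by
    have h := (LinearMap.IsIdempotentElem.isProj_range _ hP).trace
    rw [map_smul, htr, smul_eq_mul, inv_mul_cancel₀ ha] at h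
    exact_mod_cast h.symm
  obtain ⟨⟨v, hv⟩, hv0, hspan⟩ := finrank_eq_one_iff'.1 hrank
  have hv0 : v ≠ 0 := fun h => hv0 (Subtype.ext h)
  have hTv : ∀ χ, ∃ f : ℂ, T χ = f • v := by
    intro χ
    obtain ⟨f, hf⟩ := hspan ⟨(a⁻¹ • T) χ, LinearMap.mem_range_self _ _⟩
    refine ⟨a * f, ?_⟩
    have hf' : f • v = a⁻¹ • T χ := congrArg Subtype.val hf
    rw [mul_smul, hf', smul_smul, mul_inv_cancel₀ ha, one_smul]
  choose f hf using hTv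
  obtain ⟨ξ, hξ⟩ : ∃ ξ, B ξ v ≠ 0 := by
    by_contra! h
    exact hv0 (hB.2 v h)
  -- With `ξ` fixed so that `B ξ v ≠ 0`, self-adjointness reads `f ξ * B v χ = f χ * B ξ v`.
  have hfB : ∀ χ, f χ = f ξ / B ξ v * B χ v := by
    intro χ
    have h := hadj ξ χ
    rw [hf, hf, map_smul, map_smul, LinearMap.smul_apply, smul_eq_mul, smul_eq_mul] at h
    rw [hsymm χ v]
    field_simp
    linear_combination -h
  obtain ⟨t, ht⟩ := IsAlgClosed.exists_pow_nat_eq (f ξ / B ξ v) (n := 2) (by norm_num)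
  refine ⟨t • v, LinearMap.ext fun χ => ?_⟩
  rw [squareEnd_apply, hf, hfB, ← ht, map_smul, smul_smul, smul_eq_mul]
  congr 1
  ring

variable (hV : Module.finrank ℝ V = 8) (o : Orientation ℝ V (Fin 8))
variable (γ : ComplexClifford V →ₐ[ℂ] Module.End ℂ S) (hγ : IsIrreducibleModule γ)

theorem quantization_apply (α : Forms V) : quantization γ α = γ (chevalleyRiesz V α) := rfl

include hV o in
theorem finrank_complexClifford : Module.finrank ℂ (ComplexClifford V) = 256 := by
  rw [Module.finrank_eq_card_basis (cliffordBasis hV o), Fintype.card_finset, Fintype.card_fin]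
  norm_num

include hV o in
theorem finiteDimensional_complexClifford : FiniteDimensional ℂ (ComplexClifford V) :=
  .of_finrank_pos (by rw [finrank_complexClifford hV o]; norm_num)

include hV o in
-- The images of the generators again form a Clifford family, so their words stay independent.
theorem injective_of_nontrivial [Nontrivial S] : Function.Injective γ := by
  have h := ((isCliffordFamily_cliffordFrame hV o).map γ).linearIndependent_word (by decide)
  rw [Fintype.linearIndependent_iff] at h
  rw [injective_iff_map_eq_zero]
  intro z hz
  refine coeff_ext hV o fun I => ?_
  rw [map_zero]
  refine h (fun I => coeff hV o I z) ?_ I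
  simp_rw [← map_word, ← map_smul]
  rw [← map_sum, sum_coeff_smul_cword, hz]

include hV o hγ

theorem finiteDimensional_spinors : FiniteDimensional ℂ S :=
  have := finiteDimensional_complexClifford hV o
  (finiteDimensional_and_surjective_of_irreducible γ hγ).2.1

theorem bijective_of_irreducible : Function.Bijective γ := by
  have := finiteDimensional_complexClifford hV o
  obtain ⟨_, -, h⟩ := finiteDimensional_and_surjective_of_irreducible γ hγ
  exact ⟨injective_of_nontrivial hV o γ, h⟩

theorem finrank_spinors : Module.finrank ℂ S = 16 := by
  have := finiteDimensional_spinors hV o γ hγ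
  have h := (LinearEquiv.ofBijective γ.toLinearMap (bijective_of_irreducible hV o γ hγ)).finrank_eq
  rw [finrank_complexClifford hV o, Module.finrank_linearMap] at h
  nlinarith

theorem trace_apply (z : ComplexClifford V) :
    LinearMap.trace ℂ S (γ z) = 16 * coeff hV o ∅ z := by
  have := finiteDimensional_spinors hV o γ hγ
  have h : LinearMap.trace ℂ S ∘ₗ γ.toLinearMap = (16 : ℂ) • coeff hV o ∅ := by
    refine linearMap_ext_cword (hV := hV) (o := o) fun I => ?_
    rw [LinearMap.comp_apply, AlgHom.toLinearMap_apply, LinearMap.smul_apply, coeff_cword]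
    split_ifs with hI
    · rw [hI, cword, word_empty, map_one, LinearMap.trace_one, finrank_spinors hV o γ hγ]
      norm_num
    · rw [(isCliffordFamily_cliffordFrame hV o).trace_word (by decide) γ hI, smul_zero]
  exact LinearMap.congr_fun h z

theorem bijective_quantization : Function.Bijective (quantization γ) :=
  (bijective_of_irreducible hV o γ hγ).comp (chevalleyRiesz V).bijective

theorem quantization_bilinearSquare (B : LinearMap.BilinForm ℂ S) (η : S) :
    quantization γ (bilinearSquare γ B η) = squareEnd B η :=
  Function.invFun_eq ((bijective_quantization hV o γ hγ).2 _)

theorem bilinearSquare_eq_iff (B : LinearMap.BilinForm ℂ S) (η : S) (α : Forms V) :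
    bilinearSquare γ B η = α ↔ γ (chevalleyRiesz V α) = squareEnd B η := by
  rw [← quantization_apply, ← quantization_bilinearSquare hV o γ hγ,
    (bijective_quantization hV o γ hγ).1.eq_iff, eq_comm]

/-- Here `c` is the scalar coefficient of the square, equal to `B η η / 16` by the trace formula. It
may be zero, so pure spinors are covered. -/
theorem squareConditions_of_chiral {B : LinearMap.BilinForm ℂ S} (hB : IsAdmissiblePairing γ B)
    {μ : ℤˣ} {η : S} (hη : IsChiral hV o γ μ η) :
    ∃ (Ω : KForms V 4) (c : ℂ), SquareConditions hV o μ Ω (((√14 : ℝ) : ℂ) * c) ∧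
      chevalleyRiesz V (bilinearSquare γ B η) = c • 1 + chevalleyRiesz V Ω +
        (((μ : ℤ) : ℂ) * c) • cliffordVolume hV o ∧ B η η = 16 * c := by
  have := finiteDimensional_spinors hV o γ hγ
  have hinj := (bijective_of_irreducible hV o γ hγ).1
  have hz : γ (chevalleyRiesz V (bilinearSquare γ B η)) = squareEnd B η :=
    quantization_bilinearSquare hV o γ hγ B η
  generalize chevalleyRiesz V (bilinearSquare γ B η) = z at hz ⊢
  have hμ := intUnit_mul_self μ
  rw [IsChiral, quantization_apply, chevalleyRiesz_volumeForm] at hη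
  simp only [squareConditions_iff]
  generalize ((μ : ℤ) : ℂ) = m at *
  have htr : 16 * coeff hV o ∅ z = B η η := by
    rw [← trace_apply hV o γ hγ, hz, trace_squareEnd]
  have hr : CliffordAlgebra.reverse z = z := by
    refine hinj (LinearMap.ext fun χ => ?_)
    refine sub_eq_zero.1 (hB.nondegenerate.2 _ fun ξ => ?_)
    rw [map_sub, ← hB.adjoint, hz, squareEnd_apply, squareEnd_apply, map_smul, map_smul,
      LinearMap.smul_apply, smul_eq_mul, smul_eq_mul, hB.symm η χ, mul_comm, sub_self]
  have hNz : cliffordVolume hV o * z = m • z := by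
    refine hinj ?_
    rw [map_mul, map_smul, hz]
    refine LinearMap.ext fun χ => ?_
    rw [Module.End.mul_apply, LinearMap.smul_apply, squareEnd_apply, map_smul, hη, smul_comm]
  have hrN : CliffordAlgebra.reverse (cliffordVolume hV o) = cliffordVolume hV o := by
    rw [reverse_cword, Finset.card_univ, Fintype.card_fin,
      show (8 : ℕ).choose 2 = 28 by decide]
    norm_num
  -- Reversion fixes both `z` and the volume element, and so turns left chirality into right
  -- chirality.
  have hzN : z * cliffordVolume hV o = m • z := by
    have h := congrArg CliffordAlgebra.reverse hNz
    rwa [CliffordAlgebra.reverse.map_mul, map_smul, hr, hrN] at h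
  have hzz : z * z = (16 * coeff hV o ∅ z) • z := by
    refine hinj ?_
    rw [map_mul, map_smul, hz, squareEnd_mul_self, htr]
  have hdec := eq_add_fourPart_add hV o hr (hNz.trans hzN.symm)
  rw [coeff_volume_of_chiral hV o hNz] at hdec
  refine ⟨fourPart z, coeff hV o ∅ z, ⟨?_, ?_⟩, hdec, htr.symm⟩
  · have hW : chevalleyRiesz V (fourPart z : Forms V) =
        z - coeff hV o ∅ z • 1 - (m * coeff hV o ∅ z) • cliffordVolume hV o := by
      rw [eq_sub_iff_add_eq, eq_sub_iff_add_eq]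
      conv_rhs => rw [hdec]
      abel
    rw [hW, mul_sub, mul_sub, hNz, mul_smul_comm, mul_smul_comm, cword_univ_mul_self, mul_one]
    match_scalars <;> first | ring1 | linear_combination coeff hV o ∅ z * hμ
  · exact mul_self_of_square_relation hμ (cword_univ_mul_self hV o) hNz hzN hzz hdec

theorem exists_spinor_of_squareConditions {B : LinearMap.BilinForm ℂ S}
    (hB : IsAdmissiblePairing γ B) {μ : ℤˣ} {Ω : KForms V 4} {c : ℂ} (hc : c ≠ 0)
    (hΩ : SquareConditions hV o μ Ω (((√14 : ℝ) : ℂ) * c)) :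
    ∃ η : S, IsChiral hV o γ μ η ∧ B η η = 16 * c ∧
      γ (c • 1 + chevalleyRiesz V Ω + (((μ : ℤ) : ℂ) * c) • cliffordVolume hV o) =
        squareEnd B η := by
  have := finiteDimensional_spinors hV o γ hγ
  have hμ := intUnit_mul_self μ
  have hN := cword_univ_mul_self hV o
  rw [squareConditions_iff] at hΩ
  simp only [IsChiral, quantization_apply, chevalleyRiesz_volumeForm]
  generalize ((μ : ℤ) : ℂ) = m at *
  obtain ⟨hNW, hW⟩ := hΩ
  have hWN := (commute_volume hV o Ω).symm.trans hNW
  have hzz := square_relation_of_mul_self hμ hN hNW hWN hW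
  have hNz : cliffordVolume hV o *
      (c • 1 + chevalleyRiesz V Ω + (m * c) • cliffordVolume hV o) =
      m • (c • 1 + chevalleyRiesz V Ω + (m * c) • cliffordVolume hV o) := by
    rw [mul_add, mul_add, hNW, mul_smul_comm, mul_smul_comm, hN, mul_one]
    match_scalars <;> first | ring1 | linear_combination (-c) * hμ
  have hr : CliffordAlgebra.reverse
      (c • 1 + chevalleyRiesz V (Ω : Forms V) + (m * c) • cliffordVolume hV o) =
      c • 1 + chevalleyRiesz V (Ω : Forms V) + (m * c) • cliffordVolume hV o := by
    rw [map_add, map_add, map_smul, map_smul, reverse_chevalleyRiesz hV o,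
      CliffordAlgebra.reverse.map_one, reverse_cword, Finset.card_univ, Fintype.card_fin,
      show (8 : ℕ).choose 2 = 28 by decide]
    norm_num
  have hcoeff : coeff hV o ∅
      (c • 1 + chevalleyRiesz V (Ω : Forms V) + (m * c) • cliffordVolume hV o) = c := by
    rw [map_add, map_add, map_smul, map_smul, coeff_one, coeff_cword,
      coeff_eq_zero_of_card_ne hV o Ω (by simp)]
    simp [Finset.univ_eq_empty_iff]
  generalize c • 1 + chevalleyRiesz V (Ω : Forms V) + (m * c) • cliffordVolume hV o = z at *
  have htr := trace_apply hV o γ hγ z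
  rw [hcoeff] at htr
  have h16 : 16 * c ≠ 0 := mul_ne_zero (by norm_num) hc
  obtain ⟨η, hη⟩ := exists_eq_squareEnd hB.nondegenerate hB.symm (T := γ z) h16
    (by rw [← map_mul, hzz, map_smul]) htr (fun ξ χ => by rw [hB.adjoint, hr])
  have hηη : B η η = 16 * c := by rw [← trace_squareEnd, ← hη, htr]
  refine ⟨η, ?_, hηη, hη⟩
  -- The image of `η` under its own square is `16 c η`, so evaluating the chirality of the form at
  -- `η` and cancelling `16 c` gives the chirality of `η`.
  have h := congrArg (fun T : Module.End ℂ S => T η) (congrArg γ hNz)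
  simp only [map_mul, map_smul, hη, Module.End.mul_apply, LinearMap.smul_apply, squareEnd_apply,
    hηη] at h
  rw [smul_comm] at h
  exact smul_right_injective S h16 h

end Spinors

/-! ### Back to polyforms, and the theorem. -/

section Main

variable {V : Type*} [NormedAddCommGroup V] [InnerProductSpace ℝ V] [FiniteDimensional ℝ V]
variable (hV : Module.finrank ℝ V = 8) (o : Orientation ℝ V (Fin 8))

/-- Pairing the duality relation with `Ω` itself gives `μ Ω ∧ Ω = s² ν`, and `μ² = 1`. This turns
the volume term of (2) into the `Ω ∧ Ω` term of (3). -/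
theorem SquareConditions.mul_self {hV : Module.finrank ℝ V = 8} {o : Orientation ℝ V (Fin 8)}
    {μ : ℤˣ} {Ω : KForms V 4} {s : ℂ} (h : SquareConditions hV o μ Ω s) :
    (Ω : Forms V) * (Ω : Forms V) = (((μ : ℤ) : ℂ) * s ^ 2) • volumeForm hV o := by
  have h1 := congrArg (((μ : ℤ) : ℂ) • ·) (h.selfDual Ω)
  simp only [Submodule.coe_smul, mul_smul_comm, smul_smul, intUnit_mul_self, one_smul] at h1
  rw [h1, h.root]

theorem chevalleyRiesz_polyform (Ω : KForms V 4) (s m : ℂ) :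
    chevalleyRiesz V (algebraMap ℂ (Forms V) s + (Ω : Forms V) + m • volumeForm hV o) =
      s • 1 + chevalleyRiesz V Ω + m • cliffordVolume hV o := by
  rw [map_add, map_add, map_smul, chevalleyRiesz_algebraMap hV o, chevalleyRiesz_volumeForm]

end Main

end SpinorSquare

end

theorem mainTheorem8
    {V : Type*} [NormedAddCommGroup V] [InnerProductSpace ℝ V] [FiniteDimensional ℝ V]
    (hV : Module.finrank ℝ V = 8) (o : Orientation ℝ V (Fin 8))
    {S : Type*} [AddCommGroup S] [Module ℂ S]
    (γ : SpinorSquare.ComplexClifford V →ₐ[ℂ] Module.End ℂ S)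
    (hγ : SpinorSquare.IsIrreducibleModule γ)
    (B : LinearMap.BilinForm ℂ S) (hB : SpinorSquare.IsAdmissiblePairing γ B) (μ : ℤˣ) :
    Function.Bijective (SpinorSquare.quantization γ) ∧
    (∀ η : S, SpinorSquare.IsChiral hV o γ μ η →
      ∃ (Ω : SpinorSquare.KForms V 4) (s : ℂ),
        SpinorSquare.SquareConditions hV o μ Ω s ∧
        SpinorSquare.bilinearSquare γ B η =
          algebraMap ℂ (SpinorSquare.Forms V) (s / ((√14 : ℝ) : ℂ))
            + (Ω : SpinorSquare.Forms V)
            + (((μ : ℤ) : ℂ) * s / ((√14 : ℝ) : ℂ)) • SpinorSquare.volumeForm hV o ∧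
        (B η η ≠ 0 ↔ SpinorSquare.formPairing Ω Ω ≠ 0)) ∧
    (∀ α : SpinorSquare.Forms V,
      (∃ η : S, SpinorSquare.IsChiral hV o γ μ η ∧ B η η ≠ 0 ∧
          SpinorSquare.bilinearSquare γ B η = α) ↔
        ∃ (Ω : SpinorSquare.KForms V 4) (s : ℂ),
          SpinorSquare.SquareConditions hV o μ Ω s ∧
          SpinorSquare.formPairing Ω Ω ≠ 0 ∧
          α = algebraMap ℂ (SpinorSquare.Forms V) (s / ((√14 : ℝ) : ℂ))
            + (Ω : SpinorSquare.Forms V)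
            + (((μ : ℤ) : ℂ) * s / ((√14 : ℝ) : ℂ)) • SpinorSquare.volumeForm hV o) ∧
    (∀ α : SpinorSquare.Forms V,
      (∃ η : S, SpinorSquare.IsChiral hV o γ μ η ∧ B η η ≠ 0 ∧
          SpinorSquare.bilinearSquare γ B η = α) ↔
        ∃ (Ω : SpinorSquare.KForms V 4) (s : ℂ),
          SpinorSquare.SquareConditions hV o μ Ω s ∧
          SpinorSquare.formPairing Ω Ω ≠ 0 ∧
          α = algebraMap ℂ (SpinorSquare.Forms V) (s / ((√14 : ℝ) : ℂ))
            + (Ω : SpinorSquare.Forms V)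
            + (((√14 : ℝ) : ℂ) * s)⁻¹ • ((Ω : SpinorSquare.Forms V) * (Ω : SpinorSquare.Forms V))) := by
  have h14 := SpinorSquare.coe_sqrt_fourteen_ne_zero
  have h1 : ∀ η : S, SpinorSquare.IsChiral hV o γ μ η →
      ∃ (Ω : SpinorSquare.KForms V 4) (s : ℂ),
        SpinorSquare.SquareConditions hV o μ Ω s ∧
        SpinorSquare.bilinearSquare γ B η =
          algebraMap ℂ (SpinorSquare.Forms V) (s / ((√14 : ℝ) : ℂ))
            + (Ω : SpinorSquare.Forms V)
            + (((μ : ℤ) : ℂ) * s / ((√14 : ℝ) : ℂ)) • SpinorSquare.volumeForm hV o ∧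
        (B η η ≠ 0 ↔ SpinorSquare.formPairing Ω Ω ≠ 0) := by
    intro η hη
    obtain ⟨Ω, c, hΩ, hz, hc⟩ := SpinorSquare.squareConditions_of_chiral hV o γ hγ hB hη
    -- The scalar coefficient `c` singles out which of the two square roots to take.
    refine ⟨Ω, ((√14 : ℝ) : ℂ) * c, hΩ, ?_, ?_⟩
    · apply (SpinorSquare.chevalleyRiesz V).injective
      rw [hz, mul_div_assoc ((μ : ℤ) : ℂ), mul_div_cancel_left₀ c h14, SpinorSquare.chevalleyRiesz_polyform]
    · rw [← hΩ.root, hc]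
      simp [h14]
  have h2 : ∀ α : SpinorSquare.Forms V,
      (∃ η : S, SpinorSquare.IsChiral hV o γ μ η ∧ B η η ≠ 0 ∧
          SpinorSquare.bilinearSquare γ B η = α) ↔
        ∃ (Ω : SpinorSquare.KForms V 4) (s : ℂ),
          SpinorSquare.SquareConditions hV o μ Ω s ∧
          SpinorSquare.formPairing Ω Ω ≠ 0 ∧
          α = algebraMap ℂ (SpinorSquare.Forms V) (s / ((√14 : ℝ) : ℂ))
            + (Ω : SpinorSquare.Forms V)
            + (((μ : ℤ) : ℂ) * s / ((√14 : ℝ) : ℂ)) • SpinorSquare.volumeForm hV o := by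
    intro α
    constructor
    · rintro ⟨η, hη, h0, rfl⟩
      obtain ⟨Ω, s, hΩ, hα, hiff⟩ := h1 η hη
      exact ⟨Ω, s, hΩ, hiff.1 h0, hα⟩
    · rintro ⟨Ω, s, hΩ, h0, rfl⟩
      rw [← hΩ.root] at h0
      obtain ⟨c, rfl⟩ : ∃ c, s = ((√14 : ℝ) : ℂ) * c := ⟨s / ((√14 : ℝ) : ℂ), by field_simp⟩
      have hc : c ≠ 0 := by
        rintro rfl
        simp at h0
      obtain ⟨η, hη, hηη, hz⟩ :=
        SpinorSquare.exists_spinor_of_squareConditions hV o γ hγ hB hc hΩ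
      refine ⟨η, hη, by simp [hηη, hc], ?_⟩
      rw [SpinorSquare.bilinearSquare_eq_iff hV o γ hγ, mul_div_assoc ((μ : ℤ) : ℂ), mul_div_cancel_left₀ c h14,
        SpinorSquare.chevalleyRiesz_polyform, hz]
  refine ⟨SpinorSquare.bijective_quantization hV o γ hγ, h1, h2, fun α => (h2 α).trans ?_⟩
  refine exists_congr fun Ω => exists_congr fun s => and_congr_right fun hΩ =>
    and_congr_right fun h0 => ?_
  rw [← hΩ.root] at h0
  have hs : s ≠ 0 := by
    rintro rfl
    simp at h0
  -- The two descriptions agree for the same `Ω` and `s`; `s ≠ 0` allows one factor `s` to cancel.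
  rw [hΩ.mul_self, smul_smul, show (((√14 : ℝ) : ℂ) * s)⁻¹ * (((μ : ℤ) : ℂ) * s ^ 2) =
    ((μ : ℤ) : ℂ) * s / ((√14 : ℝ) : ℂ) by field_simp]
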